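/- **Theorem (Stability of the safe monotone flow relative to $\mathcal C$).** Let $F:\mathbb R^n\to\mathbb R^n$ be continuously differentiable, let $g_1,\dots,g_m:\mathbb R^n\to\mathbb R$ be convex and twice continuously differentiable, let $h(x)=Hx-c$ with $H\in\mathbb R^{k\times n}$, $c\in\mathbb R^k$, and let $$\mathcal C=\{x\in\mathbb R^n : g(x)\le 0,\ h(x)=0\}.$$ Assume that the Mangasarian–Fromovitz constraint qualification holds at every $x\in\mathcal C$: the vectors $\nabla h_1(x),\dots,\nabla h_k(x)$ are linearly independent and there is $\xi\in\mathbb R^n$ with $\nabla g_i(x)^\top\xi<0$ whenever $g_i(x)=0$ and $\nabla h_j(x)^\top\xi=0$ for all $j$. Let $\alpha>0$ and let $x^*\in\mathrm{SOL}(F,\mathcal C)$, i.e. $x^*\in\mathcal C$ and $(x-x^*)^\top F(x^*)\ge 0$ for all $x\in\mathcal C$. Put $T^{(\alpha)}_{\mathcal C}(x)=\{\xi\in\mathbb R^n : \nabla g_i(x)^\top\xi\le-\alpha g_i(x)\ \forall i,\ \nabla h_j(x)^\top\xi=-\alpha h_j(x)\ \forall j\}$ and $\mathcal F(x,u,v)=-F(x)-\sum_i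 u_i\nabla g_i(x)-\sum_j v_j\nabla h_j(x)$. The safe monotone flow with parameter $\alpha$ is $\dot x=\mathcal G_\alpha(x)$, where $\mathcal G_\alpha(x)=\mathcal F(x,u,v)$ for any minimizer $(u,v)$ of $\tfrac12\big\|\sum_i u_i\nabla g_i(x)+\sum_j v_j\nabla h_j(x)\big\|^2$ over all $(u,v)\in\mathbb R^m_{\ge0}\times\mathbb R^k$ with $\mathcal F(x,u,v)\in T^{(\alpha)}_{\mathcal C}(x)$. Let $$V(x)=\tfrac12\|x-x^*\|^2-\tfrac1{\alpha^2}W(x),\qquad W(x)=\inf_{\xi\in T^{(\alpha)}_{\mathcal C}(x)}\Big\{\xi^\top F(x)+\tfrac12\|\xi\|^2\Big\}.$$ 1. If $F$ is monotone, i.e. $(x-y)^\top(F(x)-F(y))\ge0$ for all $x,y$, then $x^*$ is globally Lyapunov stable relative to $\mathcal C$ for the safe monotone flow: from every $x_0\in\mathcal C$ there starts a solution on $[0,\infty)$; every solution starting in $\mathcal C$ stays in $\mathcal C$; for every $\varepsilon>0$ there is $\delta>0$ such that every solution with $x(0)\in\mathcal C$, $\|x(0)-x^*\|<\delta$ satisfies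 $\|x(t)-x^*\|<\varepsilon$ for all $t\ge 0$ in its interval of definition; and for every $R$ there is $M$ such that every solution with $x(0)\in\mathcal C$, $\|x(0)-x^*\|\le R$ satisfies $\|x(t)-x^*\|\le M$ for all such $t$. Moreover $V$ is a Lyapunov function on $\mathcal C$: it is continuous on $\mathcal C$, $V(x^*)=0$, $V(x)>0$ for $x\in\mathcal C\setminus\{x^*\}$, and for every solution with $x(0)\in\mathcal C$ $$\limsup_{t\to0^+}\frac{V(x(t))-V(x(0))}{t}\le0.$$ 2. If $F$ is $\mu$-strongly monotone with $\mu>0$, i.e. $(x-y)^\top(F(x)-F(y))\ge\mu\|x-y\|^2$ for all $x,y$, then $x^*$ is globally asymptotically stable relative to $\mathcal C$: it is globally Lyapunov stable relative to $\mathcal C$ in the sense of 1, and every solution on $[0,\infty)$ starting in $\mathcal C$ converges to $x^*$. Moreover $V$ is continuous on $\mathcal C$, $V(x^*)=0$, $V>0$ on $\mathcal C\setminus\{x^*\}$, and for every solution with $x(0)\in\mathcal C$ $$\limsup_{t\to0^+}\frac{V(x(t))-V(x(0))}{t}\le-\mu\|x(0)-x^*\|^2.$$ -/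

import Mathlib

open scoped Gradient RealInnerProductSpace

noncomputable section

namespace SafeMonotoneFlow

/-- `ℝⁿ` with the Euclidean norm. -/
abbrev E (n : ℕ) : Type := EuclideanSpace ℝ (Fin n)

variable {n m k : ℕ}

/-! ### Variational inequalities -/

/-- `F` is monotone. -/
def IsMonotoneMap (F : E n → E n) : Prop :=
  ∀ x y : E n, 0 ≤ ⟪x - y, F x - F y⟫

/-- The defining inequality of `μ`-strong monotonicity (used with `0 < μ`). -/
def IsStronglyMonotoneMap (μ : ℝ) (F : E n → E n) : Prop :=
  ∀ x y : E n, μ * ‖x - y‖ ^ 2 ≤ ⟪x - y, F x - F y⟫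

/-- `SOL(F, C)`: the solution set of the variational inequality `VI(F, C)`. -/
def viSol (F : E n → E n) (C : Set (E n)) : Set (E n) :=
  {x | x ∈ C ∧ ∀ y ∈ C, 0 ≤ ⟪y - x, F x⟫}

/-- The components of the affine map `h(x) = H x - c`. -/
def affineMap (H : Matrix (Fin k) (Fin n) ℝ) (c : Fin k → ℝ) (j : Fin k) (x : E n) : ℝ :=
  H.mulVec x.ofLp j - c j

/-- `C = {x | g(x) ≤ 0, h(x) = 0}`. -/
def constraintSet (g : Fin m → E n → ℝ) (h : Fin k → E n → ℝ) : Set (E n) :=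
  {x | (∀ i, g i x ≤ 0) ∧ ∀ j, h j x = 0}

/-- The Mangasarian-Fromovitz constraint qualification at `x`. -/
def MFCQAt (g : Fin m → E n → ℝ) (h : Fin k → E n → ℝ) (x : E n) : Prop :=
  LinearIndependent ℝ (fun j => ∇ (h j) x) ∧
    ∃ ξ : E n, (∀ i, g i x = 0 → ⟪∇ (g i) x, ξ⟫ < 0) ∧ ∀ j, ⟪∇ (h j) x, ξ⟫ = 0

/-! ### The safe monotone flow -/

/-- `∑ uᵢ ∇gᵢ(x) + ∑ vⱼ ∇hⱼ(x)`. -/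
def constraintForce (g : Fin m → E n → ℝ) (h : Fin k → E n → ℝ) (x : E n)
    (p : (Fin m → ℝ) × (Fin k → ℝ)) : E n :=
  ∑ i, p.1 i • ∇ (g i) x + ∑ j, p.2 j • ∇ (h j) x

/-- The control-affine system `𝓕(x, u, v) = -F(x) - ∑ uᵢ ∇gᵢ(x) - ∑ vⱼ ∇hⱼ(x)`. -/
def controlSystem (F : E n → E n) (g : Fin m → E n → ℝ) (h : Fin k → E n → ℝ) (x : E n)
    (p : (Fin m → ℝ) × (Fin k → ℝ)) : E n :=
  -F x - constraintForce g h x p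

/-- The `α`-restricted tangent set at `x`. -/
def restrictedTangentSet (α : ℝ) (g : Fin m → E n → ℝ) (h : Fin k → E n → ℝ) (x : E n) :
    Set (E n) :=
  {ξ | (∀ i, ⟪∇ (g i) x, ξ⟫ ≤ -α * g i x) ∧ ∀ j, ⟪∇ (h j) x, ξ⟫ = -α * h j x}

/-- The admissible controls `(u, v)`, `u ≥ 0`, satisfying the control barrier conditions
`∇gᵢ(x)ᵀ 𝓕(x,u,v) ≤ -α gᵢ(x)` and `∇hⱼ(x)ᵀ 𝓕(x,u,v) = -α hⱼ(x)`. -/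
def Kcbf (α : ℝ) (F : E n → E n) (g : Fin m → E n → ℝ) (h : Fin k → E n → ℝ) (x : E n) :
    Set ((Fin m → ℝ) × (Fin k → ℝ)) :=
  {p | (∀ i, 0 ≤ p.1 i) ∧ controlSystem F g h x p ∈ restrictedTangentSet α g h x}

/-- The cost `J(x, u, v) = ½ ‖∑ uᵢ ∇gᵢ(x) + ∑ vⱼ ∇hⱼ(x)‖²`. -/
def controlCost (g : Fin m → E n → ℝ) (h : Fin k → E n → ℝ) (x : E n)
    (p : (Fin m → ℝ) × (Fin k → ℝ)) : ℝ :=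
  1 / 2 * ‖constraintForce g h x p‖ ^ 2

/-- The right-hand side `𝓖_α` of the safe monotone flow: the closed-loop velocities
`𝓕(x, u, v)` with `(u, v)` a minimizer of `J(x, ·)` over `Kcbf`. It is kept set-valued because the
minimizer need not be unique, and need not exist far from the constraint set. -/
def safeMonotoneFlow (α : ℝ) (F : E n → E n) (g : Fin m → E n → ℝ) (h : Fin k → E n → ℝ)
    (x : E n) : Set (E n) :=
  {ξ | ∃ p ∈ Kcbf α F g h x,
    (∀ q ∈ Kcbf α F g h x, controlCost g h x p ≤ controlCost g h x q) ∧
      ξ = controlSystem F g h x p}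

/-! ### Solutions and stability relative to a set -/

/-- `x` solves `x'(t) ∈ 𝓖(x(t))` on the interval `I` (one-sided derivatives at end points). -/
def IsSolutionOn (𝓖 : E n → Set (E n)) (x : ℝ → E n) (I : Set ℝ) : Prop :=
  ∀ t ∈ I, ∃ ξ ∈ 𝓖 (x t), HasDerivWithinAt x ξ I t

/-- `xs` is globally Lyapunov stable relative to `C`: from every point of `C` there starts a
solution on `[0, ∞)`, solutions starting in `C` remain in `C`, those starting close to `xs` remain
close to `xs`, and those starting in a bounded part of `C` are uniformly bounded. The last three
properties concern all solutions, including those on a finite interval. -/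
structure GloballyLyapunovStableRel (𝓖 : E n → Set (E n)) (C : Set (E n)) (xs : E n) :
    Prop where
  exists_solution : ∀ x₀ ∈ C, ∃ x : ℝ → E n, x 0 = x₀ ∧ IsSolutionOn 𝓖 x (Set.Ici 0)
  invariant : ∀ (T : ℝ) (x : ℝ → E n), IsSolutionOn 𝓖 x (Set.Icc 0 T) → x 0 ∈ C →
    ∀ t ∈ Set.Icc 0 T, x t ∈ C
  stable : ∀ ε > 0, ∃ δ > 0, ∀ (T : ℝ) (x : ℝ → E n), IsSolutionOn 𝓖 x (Set.Icc 0 T) →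
    x 0 ∈ C → ‖x 0 - xs‖ < δ → ∀ t ∈ Set.Icc 0 T, ‖x t - xs‖ < ε
  bounded : ∀ R : ℝ, ∃ M : ℝ, ∀ (T : ℝ) (x : ℝ → E n), IsSolutionOn 𝓖 x (Set.Icc 0 T) →
    x 0 ∈ C → ‖x 0 - xs‖ ≤ R → ∀ t ∈ Set.Icc 0 T, ‖x t - xs‖ ≤ M

/-- `xs` is globally asymptotically stable relative to `C`: globally Lyapunov stable, and every
solution on `[0, ∞)` starting in `C` converges to `xs`. -/
structure GloballyAsymptoticallyStableRel (𝓖 : E n → Set (E n)) (C : Set (E n)) (xs : E n) :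
    Prop extends GloballyLyapunovStableRel 𝓖 C xs where
  attractive : ∀ x : ℝ → E n, IsSolutionOn 𝓖 x (Set.Ici 0) → x 0 ∈ C →
    Filter.Tendsto x Filter.atTop (nhds xs)

/-! ### The Lyapunov function -/

/-- The upper-right Dini derivative of `φ` at `0`, with values in `[-∞, ∞]`. -/
def upperRightDini (φ : ℝ → ℝ) : EReal :=
  Filter.limsup (fun s : ℝ => (((φ s - φ 0) / s : ℝ) : EReal)) (nhdsWithin 0 (Set.Ioi 0))

/-- `V` is a Lyapunov function on `C` for the point `xs` whose upper-right Dini derivative along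
the flow is at most `-w` at every point of `C`. -/
structure IsLyapunovFunctionOn (𝓖 : E n → Set (E n)) (C : Set (E n)) (xs : E n)
    (V w : E n → ℝ) : Prop where
  continuousOn : ContinuousOn V C
  eq_zero : V xs = 0
  pos : ∀ x ∈ C, x ≠ xs → 0 < V x
  dini_le : ∀ T > 0, ∀ x : ℝ → E n, IsSolutionOn 𝓖 x (Set.Icc 0 T) → x 0 ∈ C →
    upperRightDini (fun t => V (x t)) ≤ ((-w (x 0) : ℝ) : EReal)

/-- The optimal value `W(x) = inf {ξᵀ F(x) + ½ ‖ξ‖² | ξ ∈ T^(α)(x)}`. On the constraint set the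
infimum is over a nonempty set (it contains `0`) and is bounded below by `-½ ‖F(x)‖²`. -/
def optimalValue (α : ℝ) (F : E n → E n) (g : Fin m → E n → ℝ) (h : Fin k → E n → ℝ)
    (x : E n) : ℝ :=
  sInf ((fun ξ : E n => ⟪ξ, F x⟫ + 1 / 2 * ‖ξ‖ ^ 2) '' restrictedTangentSet α g h x)

/-- `V(x) = ½ ‖x - xs‖² - W(x) / α²`. -/
def lyapunovCandidate (α : ℝ) (F : E n → E n) (g : Fin m → E n → ℝ) (h : Fin k → E n → ℝ)
    (xs x : E n) : ℝ :=
  1 / 2 * ‖x - xs‖ ^ 2 - 1 / α ^ 2 * optimalValue α F g h x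

end SafeMonotoneFlow

end

/-! On `C` the velocity is the projection of `-F x` onto the polyhedron `T^(α)(x)`. MFCQ supplies a
direction satisfying the inequality constraints strictly, so multipliers exist (`exists_isKKT`);
they make the velocity unique (`IsKKT.safeMonotoneFlow_eq`) and close the duality gap, so that `W`
is the maximum over multipliers of `dualValue`.

This duality replaces differentiability of `V`. With the multipliers `p` frozen, `lyapunovMajorant`
is differentiable in `x`, lies above `V` on `C`, and touches it where `p` is optimal, so its
derivative bounds the growth of `V` along the flow. With `ξ` the velocity, that derivative is `⟪x -
xs, ξ⟫`, minus `1/α²` times a curvature term in `DF` and `∑ uᵢ D∇gᵢ` that is nonnegative by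
monotonicity and convexity, plus `∑ uᵢ gᵢ` from complementary slackness. Convexity and the
variational inequality bound the first term by `-μ‖x - xs‖² - ∑ uᵢ gᵢ`, and the sums cancel
(`fderiv_lyapunovMajorant_le`).

As `0 ∈ T^(α)(x)` on `C`, `W ≤ 0` and `V ≥ ½‖x - xs‖²`; together with `V xs = 0` and continuity of
`V` this gives stability and boundedness, and strict decrease gives convergence. Invariance of `C`
is the barrier inequality `d/dt gᵢ ≤ -α gᵢ`. Existence is Peano's theorem for the velocity composed
with the projection onto `C` and cut off far away; tangency keeps solutions in `C`, and the decrease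
of `V` keeps them where the cutoff equals one. -/

noncomputable section

namespace SafeMonotoneFlow

open Set Filter Topology

/-! ### Differential inequalities -/

/-- A continuous function that at every point is touched from above by a function with slope at
most `c` grows at most linearly with slope `c`. -/
theorem le_add_mul_of_touching_majorant {φ : ℝ → ℝ} {a b c : ℝ} (hφ : ContinuousOn φ (Icc a b))
    (H : ∀ t ∈ Ico a b, ∃ (ψ : ℝ → ℝ) (d : ℝ), (∀ s ∈ Icc a b, φ s ≤ ψ s) ∧ φ t = ψ t ∧
      HasDerivWithinAt ψ d (Icc a b) t ∧ d ≤ c) :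
    ∀ t ∈ Icc a b, φ t ≤ φ a + c * (t - a) := by
  have key := image_le_of_liminf_slope_right_le_deriv_boundary (f := φ) (a := a) (b := b)
    (B := fun t => φ a + c * (t - a)) (B' := fun _ => c) hφ (by simp) (by fun_prop)
    (fun t _ => by
      simpa using (((hasDerivWithinAt_id t (Ici t)).sub_const a).const_mul c).const_add (φ a))
    (by
      intro t ht r hr
      obtain ⟨ψ, d, hle, heq, hder, hd⟩ := H t ht
      have h1 : HasDerivWithinAt ψ d (Ioi t) t :=
        (hder.mono_of_mem_nhdsWithin (Icc_mem_nhdsGT_of_mem ht))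
      have h2 := (hasDerivWithinAt_iff_tendsto_slope' (by simp)).1 h1
      have h3 := h2.eventually_lt_const (lt_of_le_of_lt hd hr)
      refine Eventually.frequently ?_
      filter_upwards [h3, Icc_mem_nhdsGT_of_mem ht, self_mem_nhdsWithin] with s hs hsI hst
      refine lt_of_le_of_lt ?_ hs
      rw [slope_def_field, slope_def_field, heq]
      have : 0 < s - t := sub_pos.2 hst
      have := hle s hsI
      gcongr)
  exact fun t ht => key ht

/-! ### Existence of solutions for bounded continuous vector fields -/

section Peano

variable {G : Type*} [NormedAddCommGroup G] [NormedSpace ℝ G]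

/-- The nodes of the explicit Euler scheme with step size `h`. -/
def eulerNode (f : G → G) (h : ℝ) (x₀ : G) : ℕ → G
  | 0 => x₀
  | i + 1 => eulerNode f h x₀ i + h • f (eulerNode f h x₀ i)

theorem norm_eulerNode_sub_le_of_le (f : G → G) {h : ℝ} (hh : 0 ≤ h) (x₀ v : G) {ε : ℝ} {l k : ℕ}
    (hlk : l ≤ k) (H : ∀ i, l ≤ i → i < k → ‖f (eulerNode f h x₀ i) - v‖ ≤ ε) :
    ‖eulerNode f h x₀ k - eulerNode f h x₀ l - (((k : ℝ) - l) * h) • v‖ ≤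
      ε * (((k : ℝ) - l) * h) := by
  induction k, hlk using Nat.le_induction with
  | base => simp
  | succ k hlk ih =>
    have h1 := ih fun i h1 h2 => H i h1 (h2.trans k.lt_succ_self)
    have h2 := H k hlk k.lt_succ_self
    have : eulerNode f h x₀ (k + 1) - eulerNode f h x₀ l - ((((k + 1 : ℕ) : ℝ) - l) * h) • v
        = (eulerNode f h x₀ k - eulerNode f h x₀ l - (((k : ℝ) - l) * h) • v)
          + h • (f (eulerNode f h x₀ k) - v) := by
      rw [eulerNode]; push_cast; module
    rw [this]
    refine (norm_add_le _ _).trans ?_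
    rw [norm_smul, Real.norm_of_nonneg hh]
    have := mul_le_mul_of_nonneg_left h2 hh
    push_cast
    linarith

/-- Summing Euler steps taken in either time order. The choice `v = 0` gives the Lipschitz bound on
nodes; `v = f (x t)` gives the derivative of the limit. -/
theorem norm_eulerNode_sub_le (f : G → G) {h : ℝ} (hh : 0 ≤ h) (x₀ v : G) {ε : ℝ} (l k : ℕ)
    (H : ∀ i, min l k ≤ i → i ≤ max l k → ‖f (eulerNode f h x₀ i) - v‖ ≤ ε) :
    ‖eulerNode f h x₀ k - eulerNode f h x₀ l - (((k : ℝ) - l) * h) • v‖ ≤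
      ε * (|(k : ℝ) - l| * h) := by
  rcases le_total l k with hlk | hlk
  · rw [abs_of_nonneg (by simpa using hlk)]
    exact norm_eulerNode_sub_le_of_le f hh x₀ v hlk fun i h1 h2 =>
      H i (by simp [hlk, h1]) (by simp [hlk, h2.le])
  · rw [abs_of_nonpos (by simpa using hlk), ← norm_neg]
    convert norm_eulerNode_sub_le_of_le f hh x₀ v hlk (ε := ε) fun i h1 h2 =>
      H i (by simp [hlk, h1]) (by simp [hlk, h2.le]) using 1
    · congr 1; module
    · ring

theorem abs_floor_mul_sub_le {s t : ℝ} (hs : 0 ≤ s) (ht : 0 ≤ t) (n : ℕ) :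
    |(⌊s * n⌋₊ : ℝ) - ⌊t * n⌋₊| ≤ |s - t| * n + 1 := by
  have h1 := Nat.floor_le (a := s * n) (by positivity)
  have h2 := Nat.lt_floor_add_one (s * n)
  have h3 := Nat.floor_le (a := t * n) (by positivity)
  have h4 := Nat.lt_floor_add_one (t * n)
  have h5 : |s - t| * n = |s * n - t * n| := by
    rw [← sub_mul, abs_mul, abs_of_nonneg (n.cast_nonneg (α := ℝ))]
  rw [h5, abs_le]
  constructor <;> linarith [le_abs_self (s * n - t * n), neg_abs_le (s * n - t * n)]

/-- Peano's theorem: a bounded continuous vector field on a finite-dimensional space has a solution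
on `[0, ∞)` from every initial value. -/
theorem exists_solution_of_continuous_of_bounded [FiniteDimensional ℝ G] {f : G → G}
    (hf : Continuous f) {M : ℝ} (hM : ∀ x, ‖f x‖ ≤ M) (x₀ : G) :
    ∃ x : ℝ → G, x 0 = x₀ ∧ ∀ t ∈ Ici (0 : ℝ), HasDerivWithinAt x (f (x t)) (Ici 0) t := by
  have hM0 : 0 ≤ M := (norm_nonneg _).trans (hM x₀)
  have : ProperSpace G := FiniteDimensional.proper ℝ G
  -- A free ultrafilter makes the bounded approximations converge at every time simultaneously, so
  -- no subsequence has to be extracted.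
  let U : Ultrafilter ℕ := hyperfilter ℕ
  have hU : (U : Filter ℕ) ≤ atTop := Nat.hyperfilter_le_atTop
  let y : ℝ → ℕ → G := fun t n => eulerNode f (1 / (n : ℝ)) x₀ ⌊t * n⌋₊
  have hinv : Tendsto (fun n : ℕ => 1 / (n : ℝ)) U (𝓝 0) :=
    tendsto_one_div_atTop_nhds_zero_nat.mono_left hU
  have hpos : ∀ᶠ n : ℕ in U, 0 < (n : ℝ) := hU <| by
    filter_upwards [eventually_gt_atTop 0] with n hn using by exact_mod_cast hn
  have hfloor : ∀ t : ℝ, 0 ≤ t → Tendsto (fun n : ℕ => (⌊t * n⌋₊ : ℝ) * (1 / n)) U (𝓝 t) := by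
    intro t ht
    have := ((tendsto_nat_floor_mul_div_atTop ht).comp
      (tendsto_natCast_atTop_atTop (R := ℝ))).mono_left hU
    simpa [Function.comp_def, div_eq_mul_inv] using this
  have hlip : ∀ (n l k : ℕ), ‖eulerNode f (1 / (n : ℝ)) x₀ k - eulerNode f (1 / (n : ℝ)) x₀ l‖ ≤
      M * (|(k : ℝ) - l| * (1 / n)) := fun n l k => by
    simpa using norm_eulerNode_sub_le f (h := 1 / (n : ℝ)) (by positivity) x₀ 0 l k (ε := M)
      (fun i _ _ => by simpa using hM _)
  have hlim : ∀ t : ℝ, ∃ z, 0 ≤ t → Tendsto (y t) U (𝓝 z) := by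
    intro t
    by_cases ht : 0 ≤ t
    swap
    · exact ⟨0, fun h => absurd h ht⟩
    have hmem : ∀ᶠ n in U, y t n ∈ Metric.closedBall x₀ (M * t) := by
      filter_upwards [hpos] with n hn
      rw [mem_closedBall_iff_norm]
      refine (hlip n 0 ⌊t * n⌋₊).trans ?_
      have h3 := Nat.floor_le (a := t * n) (by positivity)
      refine mul_le_mul_of_nonneg_left ?_ hM0
      rw [mul_one_div, div_le_iff₀ hn]
      simpa using h3
    obtain ⟨z, -, hz⟩ := (isCompact_closedBall x₀ (M * t)).ultrafilter_le_nhds (U.map (y t))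
      (le_principal_iff.2 hmem)
    exact ⟨z, fun _ => hz⟩
  choose x hx using hlim
  refine ⟨x, ?_, ?_⟩
  · refine tendsto_nhds_unique (hx 0 le_rfl) ?_
    simp [y, eulerNode]
  intro t ht
  have ht0 : 0 ≤ t := ht
  rw [hasDerivWithinAt_iff_isLittleO, Asymptotics.isLittleO_iff]
  intro ε hε
  obtain ⟨η, hη, hfη⟩ := Metric.continuousAt_iff.1 (hf.continuousAt (x := x t)) ε hε
  -- Budget for the distance of a node from `x t`: `η/4` for `M * |s - t|`, `η/4` for the rounding
  -- error `M / n`, and `η/2` for the convergence of `y t n`. The `+ 1` covers `M = 0`.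
  have hδ : 0 < η / (4 * (M + 1)) := by positivity
  filter_upwards [inter_mem_nhdsWithin (Ici (0 : ℝ)) (Metric.ball_mem_nhds t hδ)] with s hs
  have hs0 : 0 ≤ s := hs.1
  have hst : |s - t| < η / (4 * (M + 1)) := by simpa [Real.dist_eq] using hs.2
  have hMst : M * |s - t| < η / 4 := by
    rw [lt_div_iff₀ (by positivity)] at hst
    nlinarith [abs_nonneg (s - t)]
  have hest : ∀ᶠ n in U, ‖y s n - y t n - (((⌊s * n⌋₊ : ℝ) - ⌊t * n⌋₊) * (1 / n)) • f (x t)‖ ≤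
      ε * (|(⌊s * n⌋₊ : ℝ) - ⌊t * n⌋₊| * (1 / n)) := by
    have h1 : ∀ᶠ n in U, ‖y t n - x t‖ < η / 2 := by
      have := (hx t ht0).eventually (Metric.ball_mem_nhds (x t) (half_pos hη))
      simpa [dist_eq_norm] using this
    have h2 : ∀ᶠ n : ℕ in U, M * (1 / (n : ℝ)) < η / 4 := by
      have := hinv.const_mul M
      rw [mul_zero] at this
      exact this.eventually_lt_const (by positivity)
    filter_upwards [h1, h2, hpos] with n hn1 hn2 hn
    refine norm_eulerNode_sub_le f (by positivity) x₀ (f (x t)) _ _ fun i hi1 hi2 => ?_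
    have hi : |(i : ℝ) - ⌊t * n⌋₊| ≤ |(⌊s * n⌋₊ : ℝ) - ⌊t * n⌋₊| := by
      generalize ⌊s * n⌋₊ = a at *
      generalize ⌊t * n⌋₊ = b at *
      rcases le_total a b with hab | hab
      · simp only [hab, min_eq_right, max_eq_left] at hi1 hi2
        have e1 : (a : ℝ) ≤ i := by exact_mod_cast hi1
        have e2 : (i : ℝ) ≤ b := by exact_mod_cast hi2
        rw [abs_of_nonpos (by linarith), abs_of_nonpos (by linarith)]
        linarith
      · simp only [hab, min_eq_left, max_eq_right] at hi1 hi2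
        have e1 : (i : ℝ) ≤ a := by exact_mod_cast hi2
        have e2 : (b : ℝ) ≤ i := by exact_mod_cast hi1
        rw [abs_of_nonneg (by linarith), abs_of_nonneg (by linarith)]
        linarith
    have h4 : ‖eulerNode f (1 / (n : ℝ)) x₀ i - y t n‖ < η / 2 := by
      refine (hlip n ⌊t * n⌋₊ i).trans_lt ?_
      have h5 : |(i : ℝ) - ⌊t * n⌋₊| * (1 / n) ≤ |s - t| + 1 / n := by
        have := hi.trans (abs_floor_mul_sub_le hs0 ht0 n)
        rw [mul_one_div, div_le_iff₀ hn, add_mul, one_div, inv_mul_cancel₀ hn.ne']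
        exact this
      have := mul_le_mul_of_nonneg_left h5 hM0
      linarith
    rw [← dist_eq_norm]
    refine (hfη ?_).le
    rw [dist_eq_norm]
    calc _ = ‖(eulerNode f (1 / (n : ℝ)) x₀ i - y t n) + (y t n - x t)‖ := by congr 1; abel
      _ ≤ _ := norm_add_le _ _
      _ < η := by linarith
  have hdiff : Tendsto (fun n : ℕ => ((⌊s * n⌋₊ : ℝ) - ⌊t * n⌋₊) * (1 / n)) U (𝓝 (s - t)) := by
    simpa only [sub_mul] using (hfloor s hs0).sub (hfloor t ht0)
  have habs : Tendsto (fun n : ℕ => |(⌊s * n⌋₊ : ℝ) - ⌊t * n⌋₊| * (1 / (n : ℝ))) U (𝓝 |s - t|) := by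
    refine hdiff.abs.congr fun n => ?_
    rw [abs_mul, abs_of_nonneg (a := 1 / (n : ℝ)) (by positivity)]
  rw [Real.norm_eq_abs]
  exact le_of_tendsto_of_tendsto
    ((((hx s hs0).sub (hx t ht0)).sub (hdiff.smul_const _)).norm) (habs.const_mul ε) hest

end Peano

/-! ### Projection onto a closed convex set -/

section Projection

variable {G : Type*} [NormedAddCommGroup G] [InnerProductSpace ℝ G]

theorem exists_convexProjection [CompleteSpace G] {C : Set G} (hne : C.Nonempty)
    (hcl : IsClosed C) (hconv : Convex ℝ C) :
    ∃ P : G → G, (∀ x, P x ∈ C) ∧ ∀ x, ∀ y ∈ C, ⟪x - P x, y - P x⟫ ≤ 0 := by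
  have : ∀ x, ∃ p ∈ C, ∀ y ∈ C, ⟪x - p, y - p⟫ ≤ 0 := fun x => by
    obtain ⟨p, hp, h⟩ := exists_norm_eq_iInf_of_complete_convex hne hcl.isComplete hconv x
    exact ⟨p, hp, (norm_eq_iInf_iff_real_inner_le_zero hconv hp).1 h⟩
  choose P hP h using this
  exact ⟨P, hP, h⟩

variable {C : Set G} {P : G → G}

theorem convexProjection_eq_self (hP : ∀ x, ∀ y ∈ C, ⟪x - P x, y - P x⟫ ≤ 0) {x : G}
    (hx : x ∈ C) : P x = x := by
  have := hP x x hx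
  rw [real_inner_self_eq_norm_sq] at this
  have : ‖x - P x‖ = 0 := by nlinarith [norm_nonneg (x - P x)]
  exact (sub_eq_zero.1 (norm_eq_zero.1 this)).symm

theorem norm_convexProjection_sub_le (hmem : ∀ x, P x ∈ C)
    (hP : ∀ x, ∀ y ∈ C, ⟪x - P x, y - P x⟫ ≤ 0) (x y : G) : ‖P x - P y‖ ≤ ‖x - y‖ := by
  have h1 := hP x (P y) (hmem y)
  have h2 := hP y (P x) (hmem x)
  have h3 : ‖P x - P y‖ ^ 2 ≤ ⟪x - y, P x - P y⟫ := by
    rw [← real_inner_self_eq_norm_sq]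
    simp only [inner_sub_left, inner_sub_right] at *
    linarith
  have h4 := real_inner_le_norm (x - y) (P x - P y)
  by_contra! h
  nlinarith [norm_nonneg (x - y), norm_nonneg (P x - P y)]

theorem continuous_convexProjection (hmem : ∀ x, P x ∈ C)
    (hP : ∀ x, ∀ y ∈ C, ⟪x - P x, y - P x⟫ ≤ 0) : Continuous P :=
  (LipschitzWith.of_dist_le_mul (K := 1) fun x y => by
    simpa [dist_eq_norm] using norm_convexProjection_sub_le hmem hP x y).continuous

theorem norm_sub_convexProjection_le (hP : ∀ x, ∀ y ∈ C, ⟪x - P x, y - P x⟫ ≤ 0) (x : G) {y : G}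
    (hy : y ∈ C) : ‖x - P x‖ ^ 2 ≤ ‖x - y‖ ^ 2 := by
  have h1 := hP x y hy
  have h2 : x - y = (x - P x) - (y - P x) := by abel
  rw [h2, norm_sub_sq_real (x - P x)]
  nlinarith [sq_nonneg ‖y - P x‖]

/-- A closed convex set is invariant along a curve whose velocity never points away from the
nearest point of the set. -/
theorem mem_of_inner_velocity_nonpos (hmem : ∀ x, P x ∈ C)
    (hP : ∀ x, ∀ y ∈ C, ⟪x - P x, y - P x⟫ ≤ 0) {x v : ℝ → G}
    (hx : ∀ t ∈ Ici (0 : ℝ), HasDerivWithinAt x (v t) (Ici 0) t)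
    (hv : ∀ t ∈ Ici (0 : ℝ), ⟪x t - P (x t), v t⟫ ≤ 0) (h0 : x 0 ∈ C) :
    ∀ t ∈ Ici (0 : ℝ), x t ∈ C := by
  intro T hT
  have hxc : ContinuousOn x (Ici 0) := fun t ht => (hx t ht).continuousWithinAt
  have hxc' : ContinuousOn x (Icc 0 T) := hxc.mono Icc_subset_Ici_self
  have hPc := continuous_convexProjection hmem hP
  have key := le_add_mul_of_touching_majorant (φ := fun t => ‖x t - P (x t)‖ ^ 2) (a := 0) (b := T)
    (c := 0) ((hxc'.sub (hPc.comp_continuousOn hxc')).norm.pow 2) (by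
      intro t ht
      have htI : t ∈ Ici (0 : ℝ) := ht.1
      -- Freezing the nearest point at time `t` gives a differentiable majorant of the squared
      -- distance to `C`, with equality at `s = t`.
      refine ⟨fun s => ‖x s - P (x t)‖ ^ 2, 2 * ⟪x t - P (x t), v t⟫, ?_, rfl, ?_, ?_⟩
      · exact fun s _ => norm_sub_convexProjection_le hP _ (hmem _)
      · exact (((hx t htI).mono Icc_subset_Ici_self).sub_const _).norm_sq
      · linarith [hv t htI]) T ⟨hT, le_rfl⟩
  simp only [convexProjection_eq_self hP h0, sub_self, norm_zero] at key
  have : ‖x T - P (x T)‖ = 0 := by nlinarith [norm_nonneg (x T - P (x T))]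
  rw [sub_eq_zero.1 (norm_eq_zero.1 this)]
  exact hmem _

end Projection

/-! ### Gradients of convex functions and monotone maps -/

section Gradient

variable {G : Type*} [NormedAddCommGroup G] [InnerProductSpace ℝ G]

theorem hasDerivAt_comp_add_smul {K : Type*} [NormedAddCommGroup K] [NormedSpace ℝ K] {f : G → K}
    {x : G} (hf : DifferentiableAt ℝ f x) (ξ : G) :
    HasDerivAt (fun t : ℝ => f (x + t • ξ)) (fderiv ℝ f x ξ) 0 := by
  have h1 : HasDerivAt (fun t : ℝ => x + t • ξ) ξ 0 := by
    simpa using ((hasDerivAt_id (0 : ℝ)).smul_const ξ).const_add x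
  have h2 : HasFDerivAt f (fderiv ℝ f x) (x + (0 : ℝ) • ξ) := by simpa using hf.hasFDerivAt
  exact h2.comp_hasDerivAt 0 h1

theorem tendsto_slope_add_smul {K : Type*} [NormedAddCommGroup K] [NormedSpace ℝ K] {f : G → K}
    {x : G} (hf : DifferentiableAt ℝ f x) (ξ : G) :
    Tendsto (fun t : ℝ => t⁻¹ • (f (x + t • ξ) - f x)) (𝓝[>] 0) (𝓝 (fderiv ℝ f x ξ)) := by
  have := (hasDerivWithinAt_iff_tendsto_slope' (s := Ioi (0 : ℝ)) (by simp)).1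
    (hasDerivAt_comp_add_smul hf ξ).hasDerivWithinAt
  refine this.congr fun t => ?_
  simp [slope_def_module]

theorem inner_gradient_le_sub [CompleteSpace G] {f : G → ℝ} (hf : ConvexOn ℝ univ f) {x : G}
    (hd : DifferentiableAt ℝ f x) (y : G) : ⟪∇ f x, y - x⟫ ≤ f y - f x := by
  rw [inner_gradient_left]
  refine le_of_tendsto (tendsto_slope_add_smul hd (y - x)) ?_
  filter_upwards [Ioo_mem_nhdsGT (zero_lt_one' ℝ)] with t ht
  have h := hf.2 (mem_univ x) (mem_univ y) (sub_nonneg.2 ht.2.le) ht.1.le (by ring)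
  rw [show (1 - t) • x + t • y = x + t • (y - x) by module] at h
  rw [smul_eq_mul, inv_mul_le_iff₀ ht.1]
  simp only [smul_eq_mul] at h
  linarith

/-- Divide the inequality between `x + t • ξ` and `x` by `t²` and let `t → 0⁺`. Applied to gradients
of convex functions with `μ = 0`, it yields the sign of the Hessian form. -/
theorem le_inner_fderiv_of_monotone {F : G → G} {μ : ℝ}
    (hF : ∀ x y, μ * ‖x - y‖ ^ 2 ≤ ⟪x - y, F x - F y⟫) {x : G} (hd : DifferentiableAt ℝ F x)
    (ξ : G) : μ * ‖ξ‖ ^ 2 ≤ ⟪ξ, fderiv ℝ F x ξ⟫ := by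
  refine ge_of_tendsto ((tendsto_const_nhds (x := ξ)).inner (tendsto_slope_add_smul hd ξ)) ?_
  filter_upwards [self_mem_nhdsWithin] with t ht
  have ht : 0 < t := ht
  have h := hF (x + t • ξ) x
  rw [add_sub_cancel_left, norm_smul, inner_smul_left, mul_pow, Real.norm_of_nonneg ht.le] at h
  rw [inner_smul_right, le_inv_mul_iff₀ ht]
  simp only [conj_trivial] at h
  have : t * (t * (μ * ‖ξ‖ ^ 2)) ≤ t * ⟪ξ, F (x + t • ξ) - F x⟫ := by linarith
  exact le_of_mul_le_mul_left this ht

theorem inner_gradient_sub_nonneg [CompleteSpace G] {f : G → ℝ} (hf : ConvexOn ℝ univ f)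
    (hd : Differentiable ℝ f) (x y : G) : 0 ≤ ⟪x - y, ∇ f x - ∇ f y⟫ := by
  have h1 := inner_gradient_le_sub hf (hd x) y
  have h2 := inner_gradient_le_sub hf (hd y) x
  rw [real_inner_comm] at h1 h2
  simp only [inner_sub_left, inner_sub_right] at *
  linarith

theorem contDiff_gradient [CompleteSpace G] {f : G → ℝ} (hf : ContDiff ℝ 2 f) :
    ContDiff ℝ 1 (∇ f) := by
  have : ContDiff ℝ 1 (fderiv ℝ f) := hf.fderiv_right (by norm_num)
  exact (InnerProductSpace.toDual ℝ G).symm.toContinuousLinearEquiv.contDiff.comp this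

end Gradient

/-! ### Multipliers for linear inequality constraints -/

/-- First-order conditions at a minimizer over a half-line: for small `s` the linear term dominates,
and negative `s` is allowed once `u > 0`. Steps of size at most `|d| / (A + 1)` keep the quadratic
term below the linear one. -/
theorem nonneg_and_mul_eq_zero_of_quadratic_nonneg {u d A : ℝ} (hu : 0 ≤ u) (hA : 0 ≤ A)
    (H : ∀ s, -u ≤ s → 0 ≤ s * d + 1 / 2 * s ^ 2 * A) : 0 ≤ d ∧ u * d = 0 := by
  have hd : 0 ≤ d := by
    by_contra! hd
    have h1 : 0 < -d / (A + 1) := div_pos (by linarith) (by linarith)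
    have h2 := H (-d / (A + 1)) (by linarith)
    have h3 : -d / (A + 1) * A ≤ -d := by
      rw [div_mul_eq_mul_div, div_le_iff₀ (by linarith)]; nlinarith
    nlinarith
  refine ⟨hd, ?_⟩
  by_contra hne
  have hu' : 0 < u := hu.lt_of_ne (by rintro rfl; simp at hne)
  have hd' : 0 < d := hd.lt_of_ne (by rintro rfl; simp at hne)
  have h1 : 0 < min u (d / (A + 1)) := lt_min hu' (by positivity)
  have h2 := H (-min u (d / (A + 1))) (by simp)
  have h3 : min u (d / (A + 1)) * A ≤ d := by
    calc _ ≤ d / (A + 1) * A := mul_le_mul_of_nonneg_right (min_le_right _ _) hA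
      _ ≤ d := by rw [div_mul_eq_mul_div, div_le_iff₀ (by linarith)]; nlinarith
  nlinarith

/-- Multipliers for the projection of `-w` onto `{ξ ∈ K | ⟪a i, ξ⟫ ≤ b i}`, when this set has a
point at which all the inequalities are strict. -/
theorem exists_multipliers {G ι : Type*} [NormedAddCommGroup G] [InnerProductSpace ℝ G] [Fintype ι]
    (K : Submodule ℝ G) [K.HasOrthogonalProjection] (a : ι → G) (b : ι → ℝ) (w ζ : G)
    (hζK : ζ ∈ K) (hζ : ∀ i, ⟪a i, ζ⟫ < b i) :
    ∃ u : ι → ℝ, (∀ i, 0 ≤ u i) ∧ ∀ i, ⟪a i, -K.starProjection (w + ∑ i, u i • a i)⟫ ≤ b i ∧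
      u i * (⟪a i, -K.starProjection (w + ∑ i, u i • a i)⟫ - b i) = 0 := by
  classical
  let z : (ι → ℝ) → G := fun u => K.starProjection (w + ∑ i, u i • a i)
  -- The negated Lagrangian dual, to be minimized over `u ≥ 0`; `-z u` is the primal minimizer for
  -- multipliers `u`.
  let q : (ι → ℝ) → ℝ := fun u => 1 / 2 * ‖z u‖ ^ 2 + ∑ i, u i * b i
  have hzc : Continuous z := by fun_prop
  have hqc : Continuous q := by fun_prop
  -- Weak duality at `ζ`. The positive slacks `b i - ⟪a i, ζ⟫` make `q` coercive on `u ≥ 0`: it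
  -- exceeds `q 0` outside the box with corner `R`.
  have hlow : ∀ u, -(1 / 2 * ‖ζ‖ ^ 2) - ⟪ζ, w⟫ + ∑ i, u i * (b i - ⟪a i, ζ⟫) ≤ q u := by
    intro u
    have h1 : ⟪z u, ζ⟫ = ⟪ζ, w⟫ + ∑ i, u i * ⟪a i, ζ⟫ := by
      simp only [z]
      rw [Submodule.inner_starProjection_left_eq_right, Submodule.starProjection_eq_self_iff.2 hζK,
        inner_add_left, sum_inner, real_inner_comm]
      simp [inner_smul_left]
    have h2 : 0 ≤ ‖z u + ζ‖ ^ 2 := sq_nonneg _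
    rw [norm_add_sq_real, h1] at h2
    simp only [q, mul_sub, Finset.sum_sub_distrib]
    linarith
  let S : Set (ι → ℝ) := Ici 0
  let R : ι → ℝ := fun i => (q 0 + 1 / 2 * ‖ζ‖ ^ 2 + ⟪ζ, w⟫) / (b i - ⟪a i, ζ⟫)
  obtain ⟨u, huS, hu⟩ := hqc.continuousOn.exists_isMinOn' (s := S) isClosed_Ici (x₀ := 0)
    (by simp [S]) (by
      have hcomp : (Icc 0 R)ᶜ ∈ cocompact (ι → ℝ) := isCompact_Icc.compl_mem_cocompact
      filter_upwards [inter_mem_inf hcomp (mem_principal_self S)] with u hu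
      have huS : 0 ≤ u := hu.2
      have : ∃ i, R i < u i := by
        by_contra! h
        exact hu.1 ⟨huS, h⟩
      obtain ⟨i, hi⟩ := this
      have hbi := sub_pos.2 (hζ i)
      rw [div_lt_iff₀ hbi] at hi
      have h1 := Finset.single_le_sum (f := fun i => u i * (b i - ⟪a i, ζ⟫))
        (fun j _ => mul_nonneg (huS j) (sub_pos.2 (hζ j)).le) (Finset.mem_univ i)
      linarith [hlow u])
  have hu0 : ∀ i, 0 ≤ u i := huS
  refine ⟨u, hu0, fun i => ?_⟩
  have hexp : ∀ s : ℝ, q (u + Pi.single i s) =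
      q u + (s * (⟪a i, z u⟫ + b i) + 1 / 2 * s ^ 2 * ‖K.starProjection (a i)‖ ^ 2) := by
    intro s
    have h1 : ∑ j, (u + Pi.single i s : ι → ℝ) j • a j = ∑ j, u j • a j + s • a i := by
      simp [add_smul, Finset.sum_add_distrib, Pi.single_apply, ite_smul]
    have h2 : ∑ j, (u + Pi.single i s : ι → ℝ) j * b j = ∑ j, u j * b j + s * b i := by
      simp [add_mul, Finset.sum_add_distrib, Pi.single_apply, ite_mul]
    have h3 : z (u + Pi.single i s) = z u + s • K.starProjection (a i) := by
      simp only [z]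
      rw [h1, ← add_assoc, map_add, map_smul]
    have h4 : ⟪z u, K.starProjection (a i)⟫ = ⟪a i, z u⟫ := by
      rw [← Submodule.inner_starProjection_left_eq_right, real_inner_comm,
        Submodule.starProjection_eq_self_iff.2 (Submodule.starProjection_apply_mem K _)]
    simp only [q]
    rw [h2, h3, norm_add_sq_real, inner_smul_right, h4, norm_smul, mul_pow,
      Real.norm_eq_abs, sq_abs]
    ring
  have hmin : ∀ s, -u i ≤ s →
      0 ≤ s * (⟪a i, z u⟫ + b i) + 1 / 2 * s ^ 2 * ‖K.starProjection (a i)‖ ^ 2 := by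
    intro s hs
    have hmem : u + Pi.single i s ∈ S := by
      intro j
      by_cases hj : j = i
      · subst hj; simp; linarith
      · simpa [hj] using hu0 j
    have h1 : q u ≤ q (u + Pi.single i s) := hu hmem
    rw [hexp s] at h1
    linarith
  obtain ⟨h1, h2⟩ := nonneg_and_mul_eq_zero_of_quadratic_nonneg (hu0 i) (sq_nonneg _) hmin
  rw [inner_neg_right]
  change -⟪a i, z u⟫ ≤ b i ∧ u i * (-⟪a i, z u⟫ - b i) = 0
  exact ⟨by linarith, by linarith⟩

/-! ### The affine equality constraints -/

variable {n m k : ℕ}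

theorem affineMap_eq_inner (H : Matrix (Fin k) (Fin n) ℝ) (c : Fin k → ℝ) (j : Fin k) (x : E n) :
    affineMap H c j x = ⟪(WithLp.toLp 2 (H j) : E n), x⟫ - c j := by
  simp [affineMap, Matrix.mulVec, dotProduct, PiLp.inner_apply, mul_comm]

theorem gradient_affineMap (H : Matrix (Fin k) (Fin n) ℝ) (c : Fin k → ℝ) (j : Fin k) (x : E n) :
    ∇ (affineMap H c j) x = WithLp.toLp 2 (H j) := by
  refine HasGradientAt.gradient ?_
  rw [hasGradientAt_iff_hasFDerivAt]
  have h : affineMap H c j = fun x =>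
      InnerProductSpace.toDual ℝ (E n) (WithLp.toLp 2 (H j)) x - c j :=
    funext fun x => by rw [affineMap_eq_inner, InnerProductSpace.toDual_apply_apply]
  rw [h]
  exact (ContinuousLinearMap.hasFDerivAt _).sub_const _

theorem affineMap_sub (H : Matrix (Fin k) (Fin n) ℝ) (c : Fin k → ℝ) (j : Fin k) (x y z : E n) :
    affineMap H c j y - affineMap H c j x = ⟪∇ (affineMap H c j) z, y - x⟫ := by
  rw [gradient_affineMap, affineMap_eq_inner, affineMap_eq_inner, inner_sub_right]
  ring

theorem differentiable_affineMap (H : Matrix (Fin k) (Fin n) ℝ) (c : Fin k → ℝ) (j : Fin k) :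
    Differentiable ℝ (affineMap H c j) := by
  have h : affineMap H c j = fun x => ⟪(WithLp.toLp 2 (H j) : E n), x⟫ - c j :=
    funext fun x => affineMap_eq_inner H c j x
  rw [h]
  exact ((differentiable_const _).inner ℝ differentiable_id).sub_const _

variable {F : E n → E n} {g : Fin m → E n → ℝ} {H : Matrix (Fin k) (Fin n) ℝ} {c : Fin k → ℝ}
  {α : ℝ}

theorem isClosed_constraintSet (hg : ∀ i, Continuous (g i)) :
    IsClosed (constraintSet g (affineMap H c)) := by
  simp only [constraintSet, ofPred_and, ofPred_forall]
  exact (isClosed_iInter fun i => isClosed_le (hg i) continuous_const).inter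
    (isClosed_iInter fun j => isClosed_eq (differentiable_affineMap H c j).continuous
      continuous_const)

theorem convex_constraintSet (hg : ∀ i, ConvexOn ℝ univ (g i)) :
    Convex ℝ (constraintSet g (affineMap H c)) := by
  intro x hx y hy a b ha hb hab
  refine ⟨fun i => ?_, fun j => ?_⟩
  · have h := (hg i).2 (mem_univ x) (mem_univ y) ha hb hab
    simp only [smul_eq_mul] at h
    nlinarith [hx.1 i, hy.1 i]
  · have h1 := hx.2 j
    have h2 := hy.2 j
    rw [affineMap_eq_inner] at *
    rw [inner_add_right, inner_smul_right, inner_smul_right]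
    have : b = 1 - a := by linarith
    subst this
    linear_combination a * h1 + (1 - a) * h2

/-! ### Strictly feasible directions -/

theorem zero_mem_restrictedTangentSet {h : Fin k → E n → ℝ} (hα : 0 < α) {x : E n}
    (hx : x ∈ constraintSet g h) : (0 : E n) ∈ restrictedTangentSet α g h x := by
  refine ⟨fun i => ?_, fun j => ?_⟩
  · rw [inner_zero_right]
    nlinarith [hx.1 i]
  · rw [inner_zero_right, hx.2 j, mul_zero]

/-- A small positive multiple of the MFCQ vector works: active constraints are strict at every
positive scale, and inactive ones have the room `-α * g i x > 0`. -/
theorem exists_strict_direction {h : Fin k → E n → ℝ} (hα : 0 < α) {x : E n}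
    (hx : x ∈ constraintSet g h) (hM : MFCQAt g h x) :
    ∃ ξ : E n, (∀ i, ⟪∇ (g i) x, ξ⟫ < -α * g i x) ∧ ∀ j, ⟪∇ (h j) x, ξ⟫ = 0 := by
  obtain ⟨-, ξ, hξ, hξ'⟩ := hM
  have hev : ∀ᶠ ε : ℝ in 𝓝[>] 0, ∀ i, ε * ⟪∇ (g i) x, ξ⟫ < -α * g i x := by
    refine eventually_all.2 fun i => ?_
    rcases (hx.1 i).eq_or_lt with h0 | h0
    · filter_upwards [self_mem_nhdsWithin] with ε hε
      rw [h0, mul_zero]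
      exact mul_neg_of_pos_of_neg hε (hξ i h0)
    · have : Tendsto (fun ε : ℝ => ε * ⟪∇ (g i) x, ξ⟫) (𝓝[>] 0) (𝓝 (0 * ⟪∇ (g i) x, ξ⟫)) :=
        (tendsto_id.mono_left nhdsWithin_le_nhds).mul_const _
      rw [zero_mul] at this
      exact this.eventually_lt_const (by nlinarith)
  obtain ⟨ε, hε⟩ := hev.exists
  exact ⟨ε • ξ, fun i => by simpa [inner_smul_right] using hε i,
    fun j => by rw [inner_smul_right, hξ' j, mul_zero]⟩

/-- Letting `ε → 0`, every element of the restricted tangent set is a limit of strict ones, which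
survive small perturbations of the base point within `C`. -/
theorem strict_of_mem_of_strict {h : Fin k → E n → ℝ} {x ξ ζ : E n}
    (hx : x ∈ constraintSet g h) (hξ : ξ ∈ restrictedTangentSet α g h x)
    (hζ : (∀ i, ⟪∇ (g i) x, ζ⟫ < -α * g i x) ∧ ∀ j, ⟪∇ (h j) x, ζ⟫ = 0) {ε : ℝ}
    (hε : ε ∈ Ioo (0 : ℝ) 1) :
    (∀ i, ⟪∇ (g i) x, ξ + ε • (ζ - ξ)⟫ < -α * g i x) ∧
      ∀ j, ⟪∇ (h j) x, ξ + ε • (ζ - ξ)⟫ = 0 := by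
  simp only [inner_add_right, inner_smul_right, inner_sub_right]
  refine ⟨fun i => ?_, fun j => ?_⟩
  · have h1 := hξ.1 i
    have h2 := hζ.1 i
    nlinarith [hε.1, hε.2]
  · rw [hζ.2 j, hξ.2 j, hx.2 j]
    ring

/-- Vectors of the restricted tangent set are tangent to the constraint set: they make an obtuse
angle with every normal vector. -/
theorem inner_nonpos_of_mem_restrictedTangentSet (hα : 0 < α) (hg : ∀ i, Differentiable ℝ (g i))
    {x : E n} (hx : x ∈ constraintSet g (affineMap H c)) (hM : MFCQAt g (affineMap H c) x)
    {ξ : E n} (hξ : ξ ∈ restrictedTangentSet α g (affineMap H c) x) {w : E n}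
    (hw : ∀ y ∈ constraintSet g (affineMap H c), ⟪w, y - x⟫ ≤ 0) : ⟪w, ξ⟫ ≤ 0 := by
  obtain ⟨ζ, hζ⟩ := exists_strict_direction hα hx hM
  have hstrict : ∀ ε ∈ Ioo (0 : ℝ) 1, ⟪w, ξ + ε • (ζ - ξ)⟫ ≤ 0 := by
    intro ε hε
    obtain ⟨h1, h2⟩ := strict_of_mem_of_strict hx hξ hζ hε
    generalize ξ + ε • (ζ - ξ) = η at *
    have hev : ∀ᶠ t : ℝ in 𝓝[>] 0, ∀ i, t⁻¹ • (g i (x + t • η) - g i x) < -α * g i x := by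
      refine eventually_all.2 fun i => ?_
      have := tendsto_slope_add_smul (hg i x) η
      rw [← inner_gradient_left] at this
      exact this.eventually_lt_const (h1 i)
    -- For `t < 1 / α` the slope bound gives `g i (x + t • η) < (1 - t * α) * g i x ≤ 0`, so the
    -- displaced point is feasible.
    have hsmall : Ioo (0 : ℝ) (1 / α) ∈ 𝓝[>] (0 : ℝ) := Ioo_mem_nhdsGT (by positivity)
    obtain ⟨t, ht, ht0⟩ := (hev.and hsmall).exists
    have hmem : x + t • η ∈ constraintSet g (affineMap H c) := by
      refine ⟨fun i => ?_, fun j => ?_⟩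
      · have h3 := ht i
        rw [smul_eq_mul, inv_mul_lt_iff₀ ht0.1] at h3
        have h4 := hx.1 i
        have h5 : t * α < 1 := (lt_div_iff₀ hα).1 ht0.2
        nlinarith
      · have h3 := affineMap_sub H c j x (x + t • η) x
        rw [add_sub_cancel_left, inner_smul_right, h2 j, hx.2 j] at h3
        linarith
    have h3 := hw _ hmem
    rw [add_sub_cancel_left, inner_smul_right] at h3
    by_contra! h4
    nlinarith [ht0.1]
  have hlim : Tendsto (fun ε : ℝ => ⟪w, ξ + ε • (ζ - ξ)⟫) (𝓝[>] 0)
      (𝓝 ⟪w, ξ + (0 : ℝ) • (ζ - ξ)⟫) := by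
    refine Tendsto.mono_left ?_ nhdsWithin_le_nhds
    exact Continuous.tendsto (by fun_prop) 0
  rw [zero_smul, add_zero] at hlim
  refine le_of_tendsto hlim ?_
  filter_upwards [Ioo_mem_nhdsGT (zero_lt_one' ℝ)] with ε hε using hstrict ε hε

/-! ### Optimality conditions for the closed-loop velocity -/

/-- The optimality conditions of `min {½ ‖ξ + F(x)‖² | ξ ∈ T^(α)(x)}` for the multipliers `p`, with
`ξ = 𝓕(x, p)`. -/
structure IsKKT (α : ℝ) (F : E n → E n) (g : Fin m → E n → ℝ) (h : Fin k → E n → ℝ) (x : E n)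
    (p : (Fin m → ℝ) × (Fin k → ℝ)) : Prop where
  nonneg : ∀ i, 0 ≤ p.1 i
  mem : controlSystem F g h x p ∈ restrictedTangentSet α g h x
  compl : ∀ i, p.1 i * ⟪∇ (g i) x, controlSystem F g h x p⟫ = p.1 i * (-α * g i x)

/-- Projecting onto the orthogonal complement of the span of the `∇ (h j) x` leaves only
inequalities for `exists_multipliers`. The component in the span, written in these gradients,
supplies the equality multipliers, with a minus sign because it is subtracted. -/
theorem exists_isKKT {h : Fin k → E n → ℝ} (hα : 0 < α) (F : E n → E n) {x : E n}
    (hx : x ∈ constraintSet g h) (hM : MFCQAt g h x) : ∃ p, IsKKT α F g h x p := by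
  obtain ⟨ζ, hζ1, hζ2⟩ := exists_strict_direction hα hx hM
  let L : Submodule ℝ (E n) := Submodule.span ℝ (range fun j => ∇ (h j) x)
  have hζL : ζ ∈ Lᗮ := by
    rw [Submodule.mem_orthogonal]
    intro u hu
    induction hu using Submodule.span_induction with
    | mem u hu => obtain ⟨j, rfl⟩ := hu; exact hζ2 j
    | zero => simp
    | add u v _ _ hu hv => rw [inner_add_left, hu, hv, add_zero]
    | smul a u _ hu => rw [inner_smul_left, hu, mul_zero]
  obtain ⟨u, hu0, hu⟩ := exists_multipliers Lᗮ (fun i => ∇ (g i) x) (fun i => -α * g i x) (F x) ζ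
    hζL hζ1
  set w : E n := F x + ∑ i, u i • ∇ (g i) x with hw
  obtain ⟨v, hv⟩ := (Submodule.mem_span_range_iff_exists_fun ℝ).1
    (Submodule.starProjection_apply_mem L w)
  have hsys : controlSystem F g h x (u, fun j => -v j) = -Lᗮ.starProjection w := by
    have h1 : Lᗮ.starProjection w = w - L.starProjection w := by
      rw [Submodule.starProjection_orthogonal']; simp
    rw [h1, ← hv, hw]
    simp only [controlSystem, constraintForce, neg_smul, Finset.sum_neg_distrib]
    abel
  refine ⟨(u, fun j => -v j), hu0, ?_, fun i => ?_⟩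
  · rw [hsys]
    refine ⟨fun i => (hu i).1, fun j => ?_⟩
    rw [hx.2 j, mul_zero]
    exact (Submodule.mem_orthogonal _ _).1 (neg_mem (Submodule.starProjection_apply_mem Lᗮ w)) _
      (Submodule.subset_span ⟨j, rfl⟩)
  · rw [hsys]
    have := (hu i).2
    linarith

theorem inner_constraintForce (g : Fin m → E n → ℝ) (h : Fin k → E n → ℝ) (x : E n)
    (p : (Fin m → ℝ) × (Fin k → ℝ)) (ζ : E n) :
    ⟪constraintForce g h x p, ζ⟫ =
      ∑ i, p.1 i * ⟪∇ (g i) x, ζ⟫ + ∑ j, p.2 j * ⟪∇ (h j) x, ζ⟫ := by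
  simp [constraintForce, inner_add_left, sum_inner, inner_smul_left]

/-! ### The velocity as a projection, and duality for `optimalValue` -/

section KKT

variable {h : Fin k → E n → ℝ} {x : E n} {p : (Fin m → ℝ) × (Fin k → ℝ)}

theorem inner_constraintForce_le (hp : ∀ i, 0 ≤ p.1 i) {ζ : E n}
    (hζ : ζ ∈ restrictedTangentSet α g h x) :
    ⟪constraintForce g h x p, ζ⟫ ≤ -α * (∑ i, p.1 i * g i x + ∑ j, p.2 j * h j x) := by
  rw [inner_constraintForce, mul_add, Finset.mul_sum, Finset.mul_sum]
  refine add_le_add (Finset.sum_le_sum fun i _ => ?_) (Finset.sum_le_sum fun j _ => ?_)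
  · have := mul_le_mul_of_nonneg_left (hζ.1 i) (hp i)
    linarith
  · rw [hζ.2 j]
    apply le_of_eq; ring

theorem IsKKT.inner_constraintForce_eq (hp : IsKKT α F g h x p) :
    ⟪constraintForce g h x p, controlSystem F g h x p⟫ =
      -α * (∑ i, p.1 i * g i x + ∑ j, p.2 j * h j x) := by
  rw [inner_constraintForce, mul_add, Finset.mul_sum, Finset.mul_sum]
  congr 1
  · exact Finset.sum_congr rfl fun i _ => by rw [hp.compl i]; ring
  · exact Finset.sum_congr rfl fun j _ => by rw [hp.mem.2 j]; ring

theorem controlSystem_add (F : E n → E n) (g : Fin m → E n → ℝ) (h : Fin k → E n → ℝ) (x : E n)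
    (p : (Fin m → ℝ) × (Fin k → ℝ)) :
    controlSystem F g h x p + F x = -constraintForce g h x p := by
  simp only [controlSystem]; abel

/-- The obtuse-angle characterization of the projection of `-F x` onto the convex restricted tangent
set: complementary slackness makes the cross term nonnegative. -/
theorem IsKKT.norm_sq_add_norm_sq_le (hp : IsKKT α F g h x p) {ζ : E n}
    (hζ : ζ ∈ restrictedTangentSet α g h x) :
    ‖ζ - controlSystem F g h x p‖ ^ 2 + ‖controlSystem F g h x p + F x‖ ^ 2 ≤ ‖ζ + F x‖ ^ 2 := by
  have h1 := inner_constraintForce_le hp.nonneg hζ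
  rw [← hp.inner_constraintForce_eq] at h1
  have h2 : ζ + F x = (ζ - controlSystem F g h x p) + (controlSystem F g h x p + F x) := by abel
  rw [controlSystem_add] at h2 ⊢
  rw [h2, norm_add_sq_real, inner_neg_right, real_inner_comm, inner_sub_right]
  linarith

/-- The cost is half the squared distance of the velocity from `-F x`, so the projection inequality
forces a unique velocity even when the multipliers are not unique. -/
theorem IsKKT.safeMonotoneFlow_eq (hp : IsKKT α F g h x p) :
    safeMonotoneFlow α F g h x = {controlSystem F g h x p} := by
  have hcost : ∀ q, controlCost g h x q = 1 / 2 * ‖controlSystem F g h x q + F x‖ ^ 2 := fun q => by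
    rw [controlCost, controlSystem_add, norm_neg]
  ext ξ
  simp only [safeMonotoneFlow, mem_ofPred_eq, mem_singleton_iff]
  constructor
  · rintro ⟨q, hq, hmin, rfl⟩
    have h1 := hmin p ⟨hp.nonneg, hp.mem⟩
    rw [hcost, hcost] at h1
    have h2 := hp.norm_sq_add_norm_sq_le hq.2
    have h3 : ‖controlSystem F g h x q - controlSystem F g h x p‖ = 0 := by
      nlinarith [norm_nonneg (controlSystem F g h x q - controlSystem F g h x p)]
    exact sub_eq_zero.1 (norm_eq_zero.1 h3)
  · rintro rfl
    refine ⟨p, ⟨hp.nonneg, hp.mem⟩, fun q hq => ?_, rfl⟩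
    rw [hcost, hcost]
    nlinarith [hp.norm_sq_add_norm_sq_le hq.2,
      sq_nonneg ‖controlSystem F g h x q - controlSystem F g h x p‖]

/-- The value at the multipliers `p` of the dual of the quadratic program defining `W(x)`. -/
def dualValue (α : ℝ) (F : E n → E n) (g : Fin m → E n → ℝ) (h : Fin k → E n → ℝ)
    (p : (Fin m → ℝ) × (Fin k → ℝ)) (x : E n) : ℝ :=
  -(1 / 2 * ‖F x + constraintForce g h x p‖ ^ 2) +
    α * (∑ i, p.1 i * g i x + ∑ j, p.2 j * h j x)

/-- Weak duality by completing the square in `ζ + F x + constraintForce`; at optimal multipliers and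
`ζ` the velocity, this sum vanishes and there is no gap. -/
theorem dualValue_le (hp : ∀ i, 0 ≤ p.1 i) {ζ : E n} (hζ : ζ ∈ restrictedTangentSet α g h x) :
    dualValue α F g h p x ≤ ⟪ζ, F x⟫ + 1 / 2 * ‖ζ‖ ^ 2 := by
  have h1 := inner_constraintForce_le hp hζ
  have h2 : 0 ≤ ‖ζ + (F x + constraintForce g h x p)‖ ^ 2 := sq_nonneg _
  rw [norm_add_sq_real, inner_add_right, real_inner_comm (constraintForce g h x p)] at h2
  rw [dualValue]
  linarith

theorem IsKKT.dualValue_eq (hp : IsKKT α F g h x p) :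
    dualValue α F g h p x =
      ⟪controlSystem F g h x p, F x⟫ + 1 / 2 * ‖controlSystem F g h x p‖ ^ 2 := by
  have h1 := hp.inner_constraintForce_eq
  have h2 : 0 = ‖controlSystem F g h x p + (F x + constraintForce g h x p)‖ ^ 2 := by
    rw [← add_assoc, controlSystem_add]; simp
  rw [norm_add_sq_real, inner_add_right,
    real_inner_comm (constraintForce g h x p)] at h2
  rw [dualValue]
  linarith

theorem dualValue_le_optimalValue (hp : ∀ i, 0 ≤ p.1 i)
    (hne : (restrictedTangentSet α g h x).Nonempty) :
    dualValue α F g h p x ≤ optimalValue α F g h x := by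
  refine le_csInf (hne.image _) ?_
  rintro _ ⟨ζ, hζ, rfl⟩
  exact dualValue_le hp hζ

theorem optimalValue_le {ζ : E n} (hζ : ζ ∈ restrictedTangentSet α g h x) :
    optimalValue α F g h x ≤ ⟪ζ, F x⟫ + 1 / 2 * ‖ζ‖ ^ 2 := by
  refine csInf_le ⟨dualValue α F g h 0 x, ?_⟩ ⟨ζ, hζ, rfl⟩
  rintro _ ⟨ζ, hζ, rfl⟩
  exact dualValue_le (fun i => le_rfl) hζ

theorem IsKKT.optimalValue_eq_dualValue (hp : IsKKT α F g h x p) :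
    optimalValue α F g h x = dualValue α F g h p x := by
  refine le_antisymm ?_ (dualValue_le_optimalValue hp.nonneg ⟨_, hp.mem⟩)
  rw [hp.dualValue_eq]
  exact optimalValue_le hp.mem

end KKT

variable {μ : ℝ} {xs : E n}


/-! ### Continuity of the closed-loop velocity -/

/-- Velocities near `x` are bounded since `0` is a competitor, and any cluster point `ζ` lies in the
restricted tangent set at `x`. A strict competitor at `x` remains admissible at nearby points of
`C`, because the `∇ (h j)` are constant; hence `ζ` is also optimal at `x` and equals the unique
projection. -/
theorem continuousOn_controlSystem (hα : 0 < α) (hF : Continuous F)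
    (hg : ∀ i, ContDiff ℝ 2 (g i))
    (hM : ∀ x ∈ constraintSet g (affineMap H c), MFCQAt g (affineMap H c) x)
    {p : E n → (Fin m → ℝ) × (Fin k → ℝ)}
    (hp : ∀ x ∈ constraintSet g (affineMap H c), IsKKT α F g (affineMap H c) x (p x)) :
    ContinuousOn (fun x => controlSystem F g (affineMap H c) x (p x))
      (constraintSet g (affineMap H c)) := by
  intro x hx
  set C := constraintSet g (affineMap H c)
  let v : E n → E n := fun x => controlSystem F g (affineMap H c) x (p x)
  have hgc : ∀ i, Continuous (g i) := fun i => (hg i).continuous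
  have hgg : ∀ i, Continuous (∇ (g i)) := fun i => (contDiff_gradient (hg i)).continuous
  change Tendsto v (𝓝[C] x) (𝓝 (v x))
  rw [tendsto_iff_ultrafilter]
  intro U hU
  have hUx : Tendsto id (U : Filter (E n)) (𝓝 x) := hU.trans nhdsWithin_le_nhds
  have hUC : ∀ᶠ y in U, y ∈ C := hU self_mem_nhdsWithin
  have hUF : Tendsto F U (𝓝 (F x)) := (hF.tendsto x).comp hUx
  have hbound : ∀ᶠ y in U, v y ∈ Metric.closedBall 0 (2 * (‖F x‖ + 1)) := by
    filter_upwards [hUC, hUF.norm.eventually_lt_const (lt_add_one _)] with y hy hFy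
    have h1 := (hp y hy).norm_sq_add_norm_sq_le (zero_mem_restrictedTangentSet hα hy)
    have h2 : ‖v y + F y‖ ≤ ‖F y‖ := by
      rw [zero_add] at h1
      refine le_of_sq_le_sq ?_ (norm_nonneg _)
      linarith [sq_nonneg ‖0 - controlSystem F g (affineMap H c) y (p y)‖]
    have h3 : ‖v y‖ ≤ ‖v y + F y‖ + ‖F y‖ := by
      simpa using norm_sub_le (v y + F y) (F y)
    rw [mem_closedBall_zero_iff]
    linarith
  obtain ⟨ζ, -, hζ⟩ := (isCompact_closedBall (0 : E n) (2 * (‖F x‖ + 1))).ultrafilter_le_nhds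
    (U.map v) (le_principal_iff.2 hbound)
  have hζ : Tendsto v U (𝓝 ζ) := hζ
  suffices ζ = v x by rwa [this] at hζ
  have hζmem : ζ ∈ restrictedTangentSet α g (affineMap H c) x := by
    refine ⟨fun i => ?_, fun j => ?_⟩
    · refine le_of_tendsto_of_tendsto ((((hgg i).tendsto x).comp hUx).inner hζ)
        ((((hgc i).tendsto x).comp hUx).const_mul (-α)) ?_
      filter_upwards [hUC] with y hy using (hp y hy).mem.1 i
    · refine tendsto_nhds_unique_of_eventuallyEq ((tendsto_const_nhds).inner hζ)
        (tendsto_const_nhds (x := -α * affineMap H c j x)) ?_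
      filter_upwards [hUC] with y hy
      have := (hp y hy).mem.2 j
      rw [hy.2 j, gradient_affineMap] at this
      rw [hx.2 j, gradient_affineMap]
      exact this
  obtain ⟨η, hη⟩ := exists_strict_direction hα hx (hM x hx)
  have hstrict : ∀ ε ∈ Ioo (0 : ℝ) 1, ‖ζ + F x‖ ^ 2 ≤ ‖v x + ε • (η - v x) + F x‖ ^ 2 := by
    intro ε hε
    obtain ⟨h1, h2⟩ := strict_of_mem_of_strict hx (hp x hx).mem hη hε
    change (∀ i, ⟪_, v x + ε • (η - v x)⟫ < _) at h1
    change (∀ j, ⟪_, v x + ε • (η - v x)⟫ = _) at h2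
    generalize v x + ε • (η - v x) = θ at *
    refine le_of_tendsto_of_tendsto ((hζ.add hUF).norm.pow 2)
      (((tendsto_const_nhds (x := θ)).add hUF).norm.pow 2) ?_
    have h3 : ∀ᶠ y in U, ∀ i, ⟪∇ (g i) y, θ⟫ < -α * g i y := by
      refine eventually_all.2 fun i => ?_
      exact Tendsto.eventually_lt ((((hgg i).tendsto x).comp hUx).inner tendsto_const_nhds)
        ((((hgc i).tendsto x).comp hUx).const_mul (-α)) (h1 i)
    filter_upwards [hUC, h3] with y hy hy3
    have hθ : θ ∈ restrictedTangentSet α g (affineMap H c) y := by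
      refine ⟨fun i => (hy3 i).le, fun j => ?_⟩
      have := h2 j
      rw [gradient_affineMap] at this
      rw [hy.2 j, gradient_affineMap, this, mul_zero]
    have := (hp y hy).norm_sq_add_norm_sq_le hθ
    change ‖controlSystem F g (affineMap H c) y (p y) + F y‖ ^ 2 ≤ _
    linarith [sq_nonneg ‖θ - controlSystem F g (affineMap H c) y (p y)‖]
  have hlim : Tendsto (fun ε : ℝ => ‖v x + ε • (η - v x) + F x‖ ^ 2) (𝓝[>] 0)
      (𝓝 (‖v x + (0 : ℝ) • (η - v x) + F x‖ ^ 2)) :=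
    Tendsto.mono_left (Continuous.tendsto (by fun_prop) 0) nhdsWithin_le_nhds
  rw [zero_smul, add_zero] at hlim
  have hle : ‖ζ + F x‖ ^ 2 ≤ ‖v x + F x‖ ^ 2 := by
    refine ge_of_tendsto hlim ?_
    filter_upwards [Ioo_mem_nhdsGT (zero_lt_one' ℝ)] with ε hε using hstrict ε hε
  have h4 : ‖ζ - v x‖ ^ 2 + ‖v x + F x‖ ^ 2 ≤ ‖ζ + F x‖ ^ 2 :=
    (hp x hx).norm_sq_add_norm_sq_le hζmem
  have h5 : ‖ζ - v x‖ = 0 := by nlinarith [norm_nonneg (ζ - v x)]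
  exact sub_eq_zero.1 (norm_eq_zero.1 h5)

/-! ### The Lyapunov function -/

theorem continuousOn_lyapunovCandidate (hα : 0 < α) (hF : Continuous F)
    (hg : ∀ i, ContDiff ℝ 2 (g i))
    (hM : ∀ x ∈ constraintSet g (affineMap H c), MFCQAt g (affineMap H c) x) :
    ContinuousOn (lyapunovCandidate α F g (affineMap H c) xs)
      (constraintSet g (affineMap H c)) := by
  have hex : ∀ x, ∃ p, x ∈ constraintSet g (affineMap H c) → IsKKT α F g (affineMap H c) x p := by
    intro x
    by_cases hx : x ∈ constraintSet g (affineMap H c)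
    · obtain ⟨p, hp⟩ := exists_isKKT hα F hx (hM x hx)
      exact ⟨p, fun _ => hp⟩
    · exact ⟨0, fun h => absurd h hx⟩
  choose p hp using hex
  have hv := continuousOn_controlSystem hα hF hg hM hp
  have hcont : ContinuousOn (fun x => 1 / 2 * ‖x - xs‖ ^ 2 - 1 / α ^ 2 *
      (⟪controlSystem F g (affineMap H c) x (p x), F x⟫ +
        1 / 2 * ‖controlSystem F g (affineMap H c) x (p x)‖ ^ 2))
      (constraintSet g (affineMap H c)) := by
    refine ContinuousOn.sub (by fun_prop) (continuousOn_const.mul ?_)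
    exact (hv.inner hF.continuousOn).add (continuousOn_const.mul (hv.norm.pow 2))
  refine hcont.congr fun x hx => ?_
  rw [lyapunovCandidate, (hp x hx).optimalValue_eq_dualValue, (hp x hx).dualValue_eq]

theorem half_norm_sq_le_lyapunovCandidate {h : Fin k → E n → ℝ} (hα : 0 < α) {x : E n}
    (hx : x ∈ constraintSet g h) :
    1 / 2 * ‖x - xs‖ ^ 2 ≤ lyapunovCandidate α F g h xs x := by
  have h1 := optimalValue_le (F := F) (zero_mem_restrictedTangentSet hα hx)
  rw [inner_zero_left, norm_zero] at h1
  have h2 : 1 / α ^ 2 * optimalValue α F g h x ≤ 0 :=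
    mul_nonpos_of_nonneg_of_nonpos (by positivity) (by linarith)
  rw [lyapunovCandidate]
  linarith

/-- Restricted tangent vectors at `xs` are tangent to `C`, and `-F xs` is normal to `C` by the
variational inequality. So `⟪ζ, F xs⟫ ≥ 0` and the infimum is attained at `ζ = 0`. -/
theorem lyapunovCandidate_self (hα : 0 < α) (hg : ∀ i, Differentiable ℝ (g i))
    (hxs : xs ∈ viSol F (constraintSet g (affineMap H c))) (hM : MFCQAt g (affineMap H c) xs) :
    lyapunovCandidate α F g (affineMap H c) xs xs = 0 := by
  have h0 := zero_mem_restrictedTangentSet hα hxs.1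
  have h1 : optimalValue α F g (affineMap H c) xs = 0 := by
    refine le_antisymm (by simpa using optimalValue_le (F := F) h0) (le_csInf ⟨_, 0, h0, rfl⟩ ?_)
    rintro _ ⟨ζ, hζ, rfl⟩
    have := inner_nonpos_of_mem_restrictedTangentSet hα hg hxs.1 hM hζ (w := -F xs) (fun y hy => by
      have := hxs.2 y hy
      rw [inner_neg_left, real_inner_comm]
      linarith)
    rw [inner_neg_left, real_inner_comm] at this
    have h2 := sq_nonneg ‖ζ‖
    simp only
    linarith
  simp [lyapunovCandidate, h1]

/-- A smooth majorant of the Lyapunov function, which touches it where `p` is optimal. -/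
def lyapunovMajorant (α : ℝ) (F : E n → E n) (g : Fin m → E n → ℝ) (h : Fin k → E n → ℝ) (xs : E n)
    (p : (Fin m → ℝ) × (Fin k → ℝ)) (x : E n) : ℝ :=
  1 / 2 * ‖x - xs‖ ^ 2 - 1 / α ^ 2 * dualValue α F g h p x

theorem lyapunovCandidate_le_majorant {h : Fin k → E n → ℝ} (hα : 0 < α) {x : E n}
    (hx : x ∈ constraintSet g h) {p : (Fin m → ℝ) × (Fin k → ℝ)} (hp : ∀ i, 0 ≤ p.1 i) :
    lyapunovCandidate α F g h xs x ≤ lyapunovMajorant α F g h xs p x := by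
  have h1 := dualValue_le_optimalValue (F := F) hp ⟨0, zero_mem_restrictedTangentSet hα hx⟩
  have h2 := mul_le_mul_of_nonneg_left h1 (a := 1 / α ^ 2) (by positivity)
  rw [lyapunovCandidate, lyapunovMajorant]
  linarith

theorem IsKKT.lyapunovCandidate_eq {h : Fin k → E n → ℝ} {x : E n}
    {p : (Fin m → ℝ) × (Fin k → ℝ)} (hp : IsKKT α F g h x p) :
    lyapunovCandidate α F g h xs x = lyapunovMajorant α F g h xs p x := by
  rw [lyapunovCandidate, lyapunovMajorant, hp.optimalValue_eq_dualValue]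

theorem differentiable_gradient_affineMap (j : Fin k) :
    Differentiable ℝ (∇ (affineMap H c j)) := by
  rw [funext (gradient_affineMap H c j)]
  exact differentiable_const _

theorem differentiable_lyapunovMajorant (hF : Differentiable ℝ F) (hg : ∀ i, ContDiff ℝ 2 (g i))
    (p : (Fin m → ℝ) × (Fin k → ℝ)) :
    Differentiable ℝ (lyapunovMajorant α F g (affineMap H c) xs p) := by
  have h1 : ∀ i, Differentiable ℝ (g i) := fun i => (hg i).differentiable (by norm_num)
  have h2 : ∀ i, Differentiable ℝ (∇ (g i)) := fun i =>
    (contDiff_gradient (hg i)).differentiable (by norm_num)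
  have h3 := differentiable_affineMap H c
  have h4 := differentiable_gradient_affineMap (H := H) (c := c)
  have h5 : Differentiable ℝ fun x => constraintForce g (affineMap H c) x p := by
    unfold constraintForce
    fun_prop
  have h6 : Differentiable ℝ fun x => ‖F x + constraintForce g (affineMap H c) x p‖ ^ 2 :=
    (hF.add h5).norm_sq ℝ
  have h7 : Differentiable ℝ fun x => ‖x - xs‖ ^ 2 :=
    (differentiable_id.sub_const xs).norm_sq ℝ
  unfold lyapunovMajorant dualValue
  fun_prop

theorem fderiv_lyapunovMajorant (hF : Differentiable ℝ F) (hg : ∀ i, ContDiff ℝ 2 (g i))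
    (p : (Fin m → ℝ) × (Fin k → ℝ)) (x ξ : E n) :
    fderiv ℝ (lyapunovMajorant α F g (affineMap H c) xs p) x ξ =
      ⟪x - xs, ξ⟫ - 1 / α ^ 2 * (-⟪F x + constraintForce g (affineMap H c) x p,
        fderiv ℝ F x ξ + ∑ i, p.1 i • fderiv ℝ (∇ (g i)) x ξ⟫ +
        α * ⟪constraintForce g (affineMap H c) x p, ξ⟫) := by
  have h1 : ∀ i, HasDerivAt (fun t : ℝ => g i (x + t • ξ)) ⟪∇ (g i) x, ξ⟫ 0 := fun i => by
    rw [inner_gradient_left]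
    exact hasDerivAt_comp_add_smul ((hg i).differentiable (by norm_num) x) ξ
  have h2 : ∀ i, HasDerivAt (fun t : ℝ => ∇ (g i) (x + t • ξ)) (fderiv ℝ (∇ (g i)) x ξ) 0 :=
    fun i => hasDerivAt_comp_add_smul ((contDiff_gradient (hg i)).differentiable (by norm_num) x) ξ
  have h3 : ∀ j, HasDerivAt (fun t : ℝ => affineMap H c j (x + t • ξ))
      ⟪∇ (affineMap H c j) x, ξ⟫ 0 := fun j => by
    rw [inner_gradient_left]
    exact hasDerivAt_comp_add_smul (differentiable_affineMap H c j x) ξ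
  have h4 : ∀ j, HasDerivAt (fun t : ℝ => ∇ (affineMap H c j) (x + t • ξ)) 0 0 := fun j => by
    simp only [gradient_affineMap]
    exact hasDerivAt_const _ _
  have h5 := hasDerivAt_comp_add_smul (hF x) ξ
  have h6 : HasDerivAt (fun t : ℝ => constraintForce g (affineMap H c) (x + t • ξ) p)
      (∑ i, p.1 i • fderiv ℝ (∇ (g i)) x ξ) 0 := by
    have := (HasDerivAt.fun_sum (u := Finset.univ) fun i _ => (h2 i).const_smul (p.1 i)).add
      (HasDerivAt.fun_sum (u := Finset.univ) fun j _ => (h4 j).const_smul (p.2 j))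
    simpa [constraintForce, Pi.add_def] using this
  have h7 : HasDerivAt (fun t : ℝ => x + t • ξ - xs) ξ 0 := by
    simpa using (((hasDerivAt_id (0 : ℝ)).smul_const ξ).const_add x).sub_const xs
  have h8 := ((h7.norm_sq.const_mul (1 / 2)).sub
    (((((h5.add h6).norm_sq).const_mul (1 / 2)).neg.add
      (((HasDerivAt.fun_sum (u := Finset.univ) fun i _ => (h1 i).const_mul (p.1 i)).add
        (HasDerivAt.fun_sum (u := Finset.univ) fun j _ =>
          (h3 j).const_mul (p.2 j))).const_mul α)).const_mul (1 / α ^ 2)))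
  have h9 := hasDerivAt_comp_add_smul
    (differentiable_lyapunovMajorant (α := α) (H := H) (c := c) (xs := xs) hF hg p x) ξ
  rw [h9.unique h8, inner_constraintForce]
  simp only [Pi.add_apply, zero_smul, add_zero]
  ring

/-- The Lyapunov function decreases in the direction of the closed-loop velocity. -/
theorem fderiv_lyapunovMajorant_le (hα : 0 < α) (hμ : 0 ≤ μ) (hF : Differentiable ℝ F)
    (hFm : IsStronglyMonotoneMap μ F) (hg : ∀ i, ContDiff ℝ 2 (g i))
    (hgc : ∀ i, ConvexOn ℝ univ (g i)) (hxs : xs ∈ viSol F (constraintSet g (affineMap H c)))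
    {x : E n} (hx : x ∈ constraintSet g (affineMap H c)) {p : (Fin m → ℝ) × (Fin k → ℝ)}
    (hp : IsKKT α F g (affineMap H c) x p) :
    fderiv ℝ (lyapunovMajorant α F g (affineMap H c) xs p) x
      (controlSystem F g (affineMap H c) x p) ≤ -(μ * ‖x - xs‖ ^ 2) := by
  have hgd : ∀ i, Differentiable ℝ (g i) := fun i => (hg i).differentiable (by norm_num)
  rw [fderiv_lyapunovMajorant hF hg, hp.inner_constraintForce_eq]
  have hforce : F x + constraintForce g (affineMap H c) x p =
      -controlSystem F g (affineMap H c) x p := by simp only [controlSystem]; abel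
  have hh : ∑ j, p.2 j * affineMap H c j x = 0 :=
    Finset.sum_eq_zero fun j _ => by rw [hx.2 j, mul_zero]
  have hcurv : 0 ≤ ⟪controlSystem F g (affineMap H c) x p,
      fderiv ℝ F x (controlSystem F g (affineMap H c) x p) +
        ∑ i, p.1 i • fderiv ℝ (∇ (g i)) x (controlSystem F g (affineMap H c) x p)⟫ := by
    rw [inner_add_right, inner_sum]
    refine add_nonneg ?_ (Finset.sum_nonneg fun i _ => ?_)
    · exact (by positivity : 0 ≤ μ * _).trans (le_inner_fderiv_of_monotone hFm (hF x) _)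
    · rw [inner_smul_right]
      refine mul_nonneg (hp.nonneg i) ?_
      have := le_inner_fderiv_of_monotone (F := ∇ (g i)) (μ := 0)
        (fun y z => by simpa using inner_gradient_sub_nonneg (hgc i) (hgd i) y z)
        ((contDiff_gradient (hg i)).differentiable (by norm_num) x)
        (controlSystem F g (affineMap H c) x p)
      simpa using this
  -- Split the velocity into `-F x` and the constraint force: strong monotonicity and the
  -- variational inequality handle the former, the gradient inequality at `xs`, where `g i xs ≤ 0`,
  -- the latter.
  have hdist : ⟪x - xs, controlSystem F g (affineMap H c) x p⟫ ≤
      -(μ * ‖x - xs‖ ^ 2) - ∑ i, p.1 i * g i x := by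
    have h1 := hFm x xs
    have h2 := hxs.2 x hx
    have h3 : ∑ i, p.1 i * g i x ≤ ⟪constraintForce g (affineMap H c) x p, x - xs⟫ := by
      rw [inner_constraintForce]
      have h4 : ∑ j, p.2 j * ⟪∇ (affineMap H c j) x, x - xs⟫ = 0 :=
        Finset.sum_eq_zero fun j _ => by
          rw [← affineMap_sub H c j xs x x, hx.2 j, hxs.1.2 j]; simp
      rw [h4, add_zero]
      refine Finset.sum_le_sum fun i _ => mul_le_mul_of_nonneg_left ?_ (hp.nonneg i)
      have h5 := inner_gradient_le_sub (hgc i) (hgd i x) xs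
      have h6 := hxs.1.1 i
      rw [← neg_sub x xs, inner_neg_right] at h5
      linarith
    have h4 : ⟪x - xs, controlSystem F g (affineMap H c) x p⟫ =
        -⟪x - xs, F x⟫ - ⟪constraintForce g (affineMap H c) x p, x - xs⟫ := by
      rw [controlSystem, inner_sub_right, inner_neg_right,
        real_inner_comm (constraintForce g (affineMap H c) x p)]
    rw [inner_sub_right] at h1
    linarith
  -- The weight `1 / α²` in `V` is chosen for this: it absorbs one `α` from `dualValue` and one from
  -- complementary slackness, so the sum cancels the one in `hdist`.
  have hα2 : 1 / α ^ 2 * (α * (-α * (∑ i, p.1 i * g i x + ∑ j, p.2 j * affineMap H c j x))) =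
      -∑ i, p.1 i * g i x := by
    rw [hh, add_zero]
    field_simp
  rw [hforce, inner_neg_left, neg_neg, mul_add, hα2]
  have := mul_nonneg (by positivity : 0 ≤ 1 / α ^ 2) hcurv
  linarith

/-- Along a curve in the constraint set that follows the flow with a nonnegative speed factor, the
Lyapunov function is touched from above by a function with the expected derivative. -/
theorem exists_majorant_along (hα : 0 < α) (hμ : 0 ≤ μ) (hF : Differentiable ℝ F)
    (hFm : IsStronglyMonotoneMap μ F) (hg : ∀ i, ContDiff ℝ 2 (g i))
    (hgc : ∀ i, ConvexOn ℝ univ (g i)) (hxs : xs ∈ viSol F (constraintSet g (affineMap H c)))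
    {x : ℝ → E n} {I : Set ℝ} {t r : ℝ} (hr : 0 ≤ r) {p : (Fin m → ℝ) × (Fin k → ℝ)}
    (hxC : ∀ s ∈ I, x s ∈ constraintSet g (affineMap H c)) (ht : t ∈ I)
    (hp : IsKKT α F g (affineMap H c) (x t) p)
    (hder : HasDerivWithinAt x (r • controlSystem F g (affineMap H c) (x t) p) I t) :
    ∃ (ψ : ℝ → ℝ) (d : ℝ), (∀ s ∈ I, lyapunovCandidate α F g (affineMap H c) xs (x s) ≤ ψ s) ∧
      lyapunovCandidate α F g (affineMap H c) xs (x t) = ψ t ∧ HasDerivWithinAt ψ d I t ∧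
      d ≤ -(r * (μ * ‖x t - xs‖ ^ 2)) := by
  refine ⟨fun s => lyapunovMajorant α F g (affineMap H c) xs p (x s), _,
    fun s hs => lyapunovCandidate_le_majorant hα (hxC s hs) hp.nonneg, hp.lyapunovCandidate_eq,
    (differentiable_lyapunovMajorant hF hg p (x t)).hasFDerivAt.comp_hasDerivWithinAt t hder, ?_⟩
  rw [map_smul, smul_eq_mul]
  have := mul_le_mul_of_nonneg_left
    (fderiv_lyapunovMajorant_le hα hμ hF hFm hg hgc hxs (hxC t ht) hp) hr
  linarith

/-- The speed factor `r` covers both the flow itself (`r = 1`) and the cut-off flow in the existence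
proof. -/
theorem lyapunovCandidate_le_along (hα : 0 < α) (hμ : 0 ≤ μ) (hF : ContDiff ℝ 1 F)
    (hFm : IsStronglyMonotoneMap μ F) (hg : ∀ i, ContDiff ℝ 2 (g i))
    (hgc : ∀ i, ConvexOn ℝ univ (g i))
    (hM : ∀ x ∈ constraintSet g (affineMap H c), MFCQAt g (affineMap H c) x)
    (hxs : xs ∈ viSol F (constraintSet g (affineMap H c)))
    {x : ℝ → E n} {r : ℝ → ℝ} {a b d : ℝ} (hr : ∀ t, 0 ≤ r t)
    (hxC : ∀ t ∈ Icc a b, x t ∈ constraintSet g (affineMap H c))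
    (hder : ∀ t ∈ Icc a b, ∃ ξ ∈ safeMonotoneFlow α F g (affineMap H c) (x t),
      HasDerivWithinAt x (r t • ξ) (Icc a b) t)
    (hd : ∀ t ∈ Icc a b, d ≤ r t * (μ * ‖x t - xs‖ ^ 2)) :
    ∀ t ∈ Icc a b, lyapunovCandidate α F g (affineMap H c) xs (x t) ≤
      lyapunovCandidate α F g (affineMap H c) xs (x a) - d * (t - a) := by
  have hcont : ContinuousOn x (Icc a b) := fun t ht => by
    obtain ⟨ξ, -, h⟩ := hder t ht
    exact h.continuousWithinAt
  have key := le_add_mul_of_touching_majorant (c := -d)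
    ((continuousOn_lyapunovCandidate (xs := xs) hα hF.continuous hg hM).comp hcont hxC) (by
      intro t ht
      have htI := Ico_subset_Icc_self ht
      obtain ⟨p, hp⟩ := exists_isKKT hα F (hxC t htI) (hM _ (hxC t htI))
      obtain ⟨ξ, hξ, hξd⟩ := hder t htI
      rw [hp.safeMonotoneFlow_eq, mem_singleton_iff] at hξ
      subst hξ
      obtain ⟨ψ, e, h1, h2, h3, h4⟩ := exists_majorant_along hα hμ
        (hF.differentiable (by norm_num)) hFm hg hgc hxs (hr t) hxC htI hp hξd
      exact ⟨ψ, e, h1, h2, h3, by linarith [hd t htI]⟩)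
  intro t ht
  have := key t ht
  simp only [Function.comp_apply] at this
  linarith


/-! ### Invariance of the constraint set -/

/-- With the integrating factor, `exp (α * t) * φ t` is nonincreasing. -/
theorem nonpos_of_deriv_le_neg_mul {φ φ' : ℝ → ℝ} {T : ℝ}
    (hφ : ∀ t ∈ Icc 0 T, HasDerivWithinAt φ (φ' t) (Icc 0 T) t)
    (hle : ∀ t ∈ Icc 0 T, φ' t ≤ -α * φ t) (h0 : φ 0 ≤ 0) : ∀ t ∈ Icc 0 T, φ t ≤ 0 := by
  have hder : ∀ t ∈ Icc 0 T, HasDerivWithinAt (fun t => Real.exp (α * t) * φ t)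
      (Real.exp (α * t) * α * φ t + Real.exp (α * t) * φ' t) (Icc 0 T) t := fun t ht => by
    have h1 : HasDerivAt (fun t => Real.exp (α * t)) (Real.exp (α * t) * α) t := by
      simpa using ((hasDerivAt_id t).const_mul α).exp
    exact h1.hasDerivWithinAt.mul (hφ t ht)
  intro t ht
  have key := le_add_mul_of_touching_majorant (c := 0)
    (fun t ht => (hder t ht).continuousWithinAt) (fun t ht => by
      have htI := Ico_subset_Icc_self ht
      refine ⟨_, _, fun s _ => le_rfl, rfl, hder t htI, ?_⟩
      have := mul_le_mul_of_nonneg_left (hle t htI) (Real.exp_pos (α * t)).le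
      linarith) t ht
  have hpos := Real.exp_pos (α * t)
  simp only [mul_zero, Real.exp_zero, one_mul, zero_mul, add_zero] at key
  by_contra! h
  nlinarith [mul_pos hpos h]

theorem mem_restrictedTangentSet_of_mem_safeMonotoneFlow {h : Fin k → E n → ℝ} {x ξ : E n}
    (hξ : ξ ∈ safeMonotoneFlow α F g h x) : ξ ∈ restrictedTangentSet α g h x := by
  obtain ⟨p, hp, -, rfl⟩ := hξ
  exact hp.2

theorem constraintSet_invariant (hg : ∀ i, Differentiable ℝ (g i)) {T : ℝ} {x : ℝ → E n}
    (hx : IsSolutionOn (safeMonotoneFlow α F g (affineMap H c)) x (Icc 0 T))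
    (h0 : x 0 ∈ constraintSet g (affineMap H c)) :
    ∀ t ∈ Icc 0 T, x t ∈ constraintSet g (affineMap H c) := by
  have hx' : ∀ t, ∃ ξ, t ∈ Icc 0 T → ξ ∈ restrictedTangentSet α g (affineMap H c) (x t) ∧
      HasDerivWithinAt x ξ (Icc 0 T) t := fun t => by
    by_cases ht : t ∈ Icc 0 T
    · obtain ⟨ξ, h1, h2⟩ := hx t ht
      exact ⟨ξ, fun _ => ⟨mem_restrictedTangentSet_of_mem_safeMonotoneFlow h1, h2⟩⟩
    · exact ⟨0, fun h => absurd h ht⟩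
  choose ξ hξ using hx'
  have hcomp : ∀ {f : E n → ℝ}, Differentiable ℝ f → ∀ t ∈ Icc 0 T,
      HasDerivWithinAt (fun s => f (x s)) ⟪∇ f (x t), ξ t⟫ (Icc 0 T) t := fun hf t ht => by
    rw [inner_gradient_left]
    exact (hf (x t)).hasFDerivAt.comp_hasDerivWithinAt t (hξ t ht).2
  intro t ht
  refine ⟨fun i => ?_, fun j => le_antisymm ?_ ?_⟩
  · exact nonpos_of_deriv_le_neg_mul (hcomp (hg i)) (fun t ht => (hξ t ht).1.1 i) (h0.1 i) t ht
  · exact nonpos_of_deriv_le_neg_mul (hcomp (differentiable_affineMap H c j))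
      (fun t ht => ((hξ t ht).1.2 j).le) (h0.2 j).le t ht
  · have := nonpos_of_deriv_le_neg_mul (α := α)
      (fun t ht => (hcomp (differentiable_affineMap H c j) t ht).fun_neg)
      (fun t ht => by rw [(hξ t ht).1.2 j]; linarith) (by rw [h0.2 j, neg_zero]) t ht
    linarith

/-! ### Existence of solutions -/

theorem exists_solution_safeMonotoneFlow (hα : 0 < α) (hF : ContDiff ℝ 1 F)
    (hFm : IsStronglyMonotoneMap 0 F) (hg : ∀ i, ContDiff ℝ 2 (g i))
    (hgc : ∀ i, ConvexOn ℝ univ (g i))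
    (hM : ∀ x ∈ constraintSet g (affineMap H c), MFCQAt g (affineMap H c) x)
    (hxs : xs ∈ viSol F (constraintSet g (affineMap H c))) {x₀ : E n}
    (hx₀ : x₀ ∈ constraintSet g (affineMap H c)) :
    ∃ x : ℝ → E n, x 0 = x₀ ∧
      IsSolutionOn (safeMonotoneFlow α F g (affineMap H c)) x (Ici 0) := by
  have hgd : ∀ i, Differentiable ℝ (g i) := fun i => (hg i).differentiable (by norm_num)
  have hex : ∀ x, ∃ p, x ∈ constraintSet g (affineMap H c) → IsKKT α F g (affineMap H c) x p := by
    intro x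
    by_cases hx : x ∈ constraintSet g (affineMap H c)
    · obtain ⟨p, hp⟩ := exists_isKKT hα F hx (hM x hx)
      exact ⟨p, fun _ => hp⟩
    · exact ⟨0, fun h => absurd h hx⟩
  choose p hp using hex
  obtain ⟨P, hPmem, hP⟩ := exists_convexProjection ⟨x₀, hx₀⟩
    (isClosed_constraintSet (H := H) (c := c) fun i => (hg i).continuous)
    (convex_constraintSet hgc)
  let v : E n → E n := fun x => controlSystem F g (affineMap H c) x (p x)
  have hvP : Continuous fun x => v (P x) :=
    (continuousOn_controlSystem hα hF.continuous hg hM hp).comp_continuous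
      (continuous_convexProjection hPmem hP) hPmem
  -- Points of `C` where `V` is at most its initial value lie within `R` of `xs`; the cutoff `χ` is
  -- `1` there and vanishes beyond `R + 1`.
  let R : ℝ := √(2 * lyapunovCandidate α F g (affineMap H c) xs x₀)
  let χ : E n → ℝ := fun x => max 0 (min 1 (R + 1 - ‖x - xs‖))
  have hχ0 : ∀ x, 0 ≤ χ x := fun x => le_max_left _ _
  have hfc : Continuous fun x => χ x • v (P x) := by
    have : Continuous χ := by fun_prop
    exact this.smul hvP
  obtain ⟨B, hB⟩ := (isCompact_closedBall xs (R + 1)).exists_bound_of_continuousOn hfc.continuousOn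
  have hbound : ∀ x, ‖χ x • v (P x)‖ ≤ max 0 B := fun x => by
    by_cases hx : x ∈ Metric.closedBall xs (R + 1)
    · exact (hB x hx).trans (le_max_right _ _)
    · rw [mem_closedBall_iff_norm, not_le] at hx
      have : χ x = 0 := max_eq_left ((min_le_right _ _).trans (by linarith))
      rw [this, zero_smul, norm_zero]
      exact le_max_left _ _
  obtain ⟨x, hx0, hx⟩ := exists_solution_of_continuous_of_bounded hfc hbound x₀
  have hxC := mem_of_inner_velocity_nonpos hPmem hP hx (fun t _ => by
    rw [inner_smul_right]
    refine mul_nonpos_of_nonneg_of_nonpos (hχ0 _) ?_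
    exact inner_nonpos_of_mem_restrictedTangentSet hα hgd (hPmem _) (hM _ (hPmem _))
      (hp _ (hPmem _)).mem (hP (x t))) (hx0 ▸ hx₀)
  have hflow : ∀ t ∈ Ici (0 : ℝ), v (x t) ∈ safeMonotoneFlow α F g (affineMap H c) (x t) :=
    fun t ht => by rw [(hp _ (hxC t ht)).safeMonotoneFlow_eq]; rfl
  have hxP : ∀ t ∈ Ici (0 : ℝ), P (x t) = x t := fun t ht =>
    convexProjection_eq_self hP (hxC t ht)
  refine ⟨x, hx0, fun t ht => ⟨v (x t), hflow t ht, ?_⟩⟩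
  -- Nonnegative speed suffices for `V` not to increase, so the bound holds before `χ = 1` is known
  -- and then implies it.
  have hV := lyapunovCandidate_le_along hα le_rfl hF hFm hg hgc hM hxs (x := x)
    (r := fun t => χ (x t)) (a := 0) (b := t) (d := 0) (fun t => hχ0 _)
    (fun s hs => hxC s hs.1)
    (fun s hs => ⟨v (x s), hflow s hs.1, by
      have := (hx s hs.1).mono (show Icc 0 t ⊆ Ici 0 from Icc_subset_Ici_self)
      rwa [hxP s hs.1] at this⟩)
    (fun s _ => by simp) t ⟨ht, le_rfl⟩
  have hle := half_norm_sq_le_lyapunovCandidate (F := F) (xs := xs) hα (hxC t ht)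
  rw [hx0] at hV
  have hR : ‖x t - xs‖ ≤ R := Real.le_sqrt_of_sq_le (by linarith)
  have hχ1 : χ (x t) = 1 := by
    simp only [χ]
    rw [min_eq_left (by linarith), max_eq_right zero_le_one]
  have := hx t ht
  rwa [hχ1, one_smul, hxP t ht] at this

/-! ### Stability -/

theorem globallyLyapunovStableRel_safeMonotoneFlow (hα : 0 < α) (hF : ContDiff ℝ 1 F)
    (hFm : IsStronglyMonotoneMap 0 F) (hg : ∀ i, ContDiff ℝ 2 (g i))
    (hgc : ∀ i, ConvexOn ℝ univ (g i))
    (hM : ∀ x ∈ constraintSet g (affineMap H c), MFCQAt g (affineMap H c) x)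
    (hxs : xs ∈ viSol F (constraintSet g (affineMap H c))) :
    GloballyLyapunovStableRel (safeMonotoneFlow α F g (affineMap H c))
      (constraintSet g (affineMap H c)) xs := by
  have hgd : ∀ i, Differentiable ℝ (g i) := fun i => (hg i).differentiable (by norm_num)
  have hVc := continuousOn_lyapunovCandidate (xs := xs) hα hF.continuous hg hM
  have hV : ∀ (T : ℝ) (x : ℝ → E n),
      IsSolutionOn (safeMonotoneFlow α F g (affineMap H c)) x (Icc 0 T) →
      x 0 ∈ constraintSet g (affineMap H c) → ∀ t ∈ Icc 0 T,
      1 / 2 * ‖x t - xs‖ ^ 2 ≤ lyapunovCandidate α F g (affineMap H c) xs (x 0) := by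
    intro T x hx h0 t ht
    have hxC := constraintSet_invariant hgd hx h0
    have h1 := lyapunovCandidate_le_along hα le_rfl hF hFm hg hgc hM hxs (x := x)
      (r := fun _ => 1) (d := 0) (fun _ => zero_le_one) hxC
      (fun s hs => by simpa using hx s hs) (fun s _ => by simp) t ht
    have h2 := half_norm_sq_le_lyapunovCandidate (F := F) (xs := xs) hα (hxC t ht)
    linarith
  refine ⟨fun x₀ hx₀ => exists_solution_safeMonotoneFlow hα hF hFm hg hgc hM hxs hx₀,
    fun T x hx h0 => constraintSet_invariant hgd hx h0, ?_, ?_⟩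
  · intro ε hε
    have h1 := (hVc xs hxs.1).eventually_lt_const (u := ε ^ 2 / 2)
      (by rw [lyapunovCandidate_self hα hgd hxs (hM xs hxs.1)]; positivity)
    obtain ⟨δ, hδ, h2⟩ := Metric.mem_nhdsWithin_iff.1 h1
    refine ⟨δ, hδ, fun T x hx h0 hx0 t ht => ?_⟩
    have h3 : lyapunovCandidate α F g (affineMap H c) xs (x 0) < ε ^ 2 / 2 :=
      h2 ⟨by rwa [Metric.mem_ball, dist_eq_norm], h0⟩
    refine lt_of_pow_lt_pow_left₀ 2 hε.le ?_
    linarith [hV T x hx h0 t ht]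
  · intro R
    have hcomp : IsCompact (constraintSet g (affineMap H c) ∩ Metric.closedBall xs R) :=
      (isCompact_closedBall xs R).inter_left (isClosed_constraintSet fun i => (hg i).continuous)
    obtain ⟨B, hB⟩ := hcomp.bddAbove_image (hVc.mono inter_subset_left)
    refine ⟨√(2 * B), fun T x hx h0 hx0 t ht => Real.le_sqrt_of_sq_le ?_⟩
    have h1 := hB ⟨x 0, ⟨h0, by rwa [mem_closedBall_iff_norm]⟩, rfl⟩
    linarith [hV T x hx h0 t ht]

theorem isLyapunovFunctionOn_lyapunovCandidate (hα : 0 < α) (hμ : 0 ≤ μ) (hF : ContDiff ℝ 1 F)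
    (hFm : IsStronglyMonotoneMap μ F) (hg : ∀ i, ContDiff ℝ 2 (g i))
    (hgc : ∀ i, ConvexOn ℝ univ (g i))
    (hM : ∀ x ∈ constraintSet g (affineMap H c), MFCQAt g (affineMap H c) x)
    (hxs : xs ∈ viSol F (constraintSet g (affineMap H c))) :
    IsLyapunovFunctionOn (safeMonotoneFlow α F g (affineMap H c))
      (constraintSet g (affineMap H c)) xs (lyapunovCandidate α F g (affineMap H c) xs)
      (fun x => μ * ‖x - xs‖ ^ 2) := by
  have hgd : ∀ i, Differentiable ℝ (g i) := fun i => (hg i).differentiable (by norm_num)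
  refine ⟨continuousOn_lyapunovCandidate hα hF.continuous hg hM,
    lyapunovCandidate_self hα hgd hxs (hM xs hxs.1), fun x hx hne => ?_, ?_⟩
  · have h1 := half_norm_sq_le_lyapunovCandidate (F := F) (xs := xs) hα hx
    have h2 : 0 < ‖x - xs‖ := norm_pos_iff.2 (sub_ne_zero.2 hne)
    exact lt_of_lt_of_le (by positivity) h1
  · intro T hT x hx h0
    have hxC := constraintSet_invariant hgd hx h0
    have h0T : (0 : ℝ) ∈ Icc 0 T := ⟨le_rfl, hT.le⟩
    obtain ⟨p, hp⟩ := exists_isKKT hα F h0 (hM _ h0)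
    obtain ⟨ξ, hξ, hξd⟩ := hx 0 h0T
    rw [hp.safeMonotoneFlow_eq, mem_singleton_iff] at hξ
    subst hξ
    -- `ψ` agrees with `V` along the curve at time `0` and lies above it later, so its derivative
    -- bounds the upper Dini derivative.
    obtain ⟨ψ, d, h1, h2, h3, h4⟩ := exists_majorant_along hα hμ
      (hF.differentiable (by norm_num)) hFm hg hgc hxs zero_le_one hxC h0T hp
      (by rwa [one_smul])
    have h5 : HasDerivWithinAt ψ d (Ioi 0) 0 :=
      h3.mono_of_mem_nhdsWithin (Icc_mem_nhdsGT hT)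
    have h6 := (hasDerivWithinAt_iff_tendsto_slope' (by simp)).1 h5
    have h7 : Tendsto (fun s : ℝ => (((ψ s - ψ 0) / s : ℝ) : EReal)) (𝓝[>] 0) (𝓝 (d : EReal)) := by
      refine (continuous_coe_real_ereal.tendsto d).comp (h6.congr fun s => ?_)
      simp [slope_def_field]
    have h8 : (d : EReal) ≤ ((-(μ * ‖x 0 - xs‖ ^ 2) : ℝ) : EReal) :=
      EReal.coe_le_coe_iff.2 (by linarith)
    refine le_trans ?_ h8
    rw [← h7.limsup_eq]
    refine limsup_le_limsup ?_
    filter_upwards [Icc_mem_nhdsGT hT, self_mem_nhdsWithin] with s hs hs0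
    have hs0 : 0 < s := hs0
    rw [EReal.coe_le_coe_iff, h2]
    have := h1 s hs
    gcongr

/-- Outside a `δ`-ball `V` falls at rate at least `μ * δ ^ 2`, so the solution must enter it; from
then on `V < ε ^ 2 / 2` persists, which confines the solution to the `ε`-ball. -/
theorem tendsto_of_isSolutionOn_Ici (hα : 0 < α) (hμ : 0 < μ) (hF : ContDiff ℝ 1 F)
    (hFm : IsStronglyMonotoneMap μ F) (hg : ∀ i, ContDiff ℝ 2 (g i))
    (hgc : ∀ i, ConvexOn ℝ univ (g i))
    (hM : ∀ x ∈ constraintSet g (affineMap H c), MFCQAt g (affineMap H c) x)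
    (hxs : xs ∈ viSol F (constraintSet g (affineMap H c))) {x : ℝ → E n}
    (hx : IsSolutionOn (safeMonotoneFlow α F g (affineMap H c)) x (Ici 0))
    (h0 : x 0 ∈ constraintSet g (affineMap H c)) : Tendsto x atTop (𝓝 xs) := by
  have hgd : ∀ i, Differentiable ℝ (g i) := fun i => (hg i).differentiable (by norm_num)
  have hxC : ∀ t, 0 ≤ t → x t ∈ constraintSet g (affineMap H c) := fun t ht =>
    constraintSet_invariant (T := t) hgd (fun s hs => by
      obtain ⟨ξ, h1, h2⟩ := hx s hs.1
      exact ⟨ξ, h1, h2.mono Icc_subset_Ici_self⟩) h0 t ⟨ht, le_rfl⟩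
  have hdec : ∀ a b d : ℝ, 0 ≤ a → a ≤ b → (∀ t ∈ Icc a b, d ≤ μ * ‖x t - xs‖ ^ 2) →
      lyapunovCandidate α F g (affineMap H c) xs (x b) ≤
        lyapunovCandidate α F g (affineMap H c) xs (x a) - d * (b - a) := by
    intro a b d ha hab hd
    refine lyapunovCandidate_le_along hα hμ.le hF hFm hg hgc hM hxs (x := x)
      (r := fun _ => 1) (fun _ => zero_le_one) (fun t ht => hxC t (ha.trans ht.1))
      (fun t ht => ?_) (by simpa using hd) b ⟨hab, le_rfl⟩
    obtain ⟨ξ, h1, h2⟩ := hx t (ha.trans ht.1)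
    refine ⟨ξ, h1, ?_⟩
    rw [one_smul]
    exact h2.mono fun s hs => ha.trans hs.1
  rw [Metric.tendsto_atTop]
  intro ε hε
  have h1 := (continuousOn_lyapunovCandidate (xs := xs) hα hF.continuous hg hM xs
    hxs.1).eventually_lt_const (u := ε ^ 2 / 2)
    (by rw [lyapunovCandidate_self hα hgd hxs (hM xs hxs.1)]; positivity)
  obtain ⟨δ, hδ, h2⟩ := Metric.mem_nhdsWithin_iff.1 h1
  have hex : ∃ t, 0 ≤ t ∧ ‖x t - xs‖ < δ := by
    by_contra! hfar
    set V₀ := lyapunovCandidate α F g (affineMap H c) xs (x 0)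
    have hV₀ : 0 ≤ V₀ := le_trans (by positivity)
      (half_norm_sq_le_lyapunovCandidate (F := F) (xs := xs) hα h0)
    -- By this time `V` would have dropped by `V₀ + 1`, to at most `-1`.
    have hT : 0 ≤ (V₀ + 1) / (μ * δ ^ 2) := by positivity
    have h3 := hdec 0 ((V₀ + 1) / (μ * δ ^ 2)) (μ * δ ^ 2) le_rfl hT (fun t ht => by
      have := hfar t ht.1
      gcongr)
    rw [sub_zero, mul_div_cancel₀ _ (by positivity)] at h3
    have h4 := half_norm_sq_le_lyapunovCandidate (F := F) (xs := xs) hα (hxC _ hT)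
    have h5 := sq_nonneg ‖x ((V₀ + 1) / (μ * δ ^ 2)) - xs‖
    linarith
  obtain ⟨t₀, ht₀, hx₀⟩ := hex
  refine ⟨t₀, fun t ht => ?_⟩
  have h3 : lyapunovCandidate α F g (affineMap H c) xs (x t₀) < ε ^ 2 / 2 :=
    h2 ⟨by rwa [Metric.mem_ball, dist_eq_norm], hxC t₀ ht₀⟩
  have h4 := hdec t₀ t 0 ht₀ ht (fun s _ => by positivity)
  have h5 := half_norm_sq_le_lyapunovCandidate (F := F) (xs := xs) hα (hxC t (ht₀.trans ht))
  rw [dist_eq_norm]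
  refine lt_of_pow_lt_pow_left₀ 2 hε.le ?_
  linarith

end SafeMonotoneFlow

end

theorem mainTheorem3 {n m k : ℕ}
    (F : SafeMonotoneFlow.E n → SafeMonotoneFlow.E n) (hF : ContDiff ℝ 1 F)
    (g : Fin m → SafeMonotoneFlow.E n → ℝ) (hg : ∀ i, ContDiff ℝ 2 (g i))
    (hg_convex : ∀ i, ConvexOn ℝ Set.univ (g i))
    (H : Matrix (Fin k) (Fin n) ℝ) (c : Fin k → ℝ)
    (α : ℝ) (hα : 0 < α)
    (hMFCQ : ∀ x ∈ SafeMonotoneFlow.constraintSet g (SafeMonotoneFlow.affineMap H c),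
      SafeMonotoneFlow.MFCQAt g (SafeMonotoneFlow.affineMap H c) x)
    (xs : SafeMonotoneFlow.E n)
    (hxs : xs ∈ SafeMonotoneFlow.viSol F
      (SafeMonotoneFlow.constraintSet g (SafeMonotoneFlow.affineMap H c))) :
    (SafeMonotoneFlow.IsMonotoneMap F →
      SafeMonotoneFlow.GloballyLyapunovStableRel
        (SafeMonotoneFlow.safeMonotoneFlow α F g (SafeMonotoneFlow.affineMap H c))
        (SafeMonotoneFlow.constraintSet g (SafeMonotoneFlow.affineMap H c)) xs ∧
      SafeMonotoneFlow.IsLyapunovFunctionOn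
        (SafeMonotoneFlow.safeMonotoneFlow α F g (SafeMonotoneFlow.affineMap H c))
        (SafeMonotoneFlow.constraintSet g (SafeMonotoneFlow.affineMap H c)) xs
        (SafeMonotoneFlow.lyapunovCandidate α F g (SafeMonotoneFlow.affineMap H c) xs)
        (fun _ => 0)) ∧
    (∀ μ : ℝ, 0 < μ → SafeMonotoneFlow.IsStronglyMonotoneMap μ F →
      SafeMonotoneFlow.GloballyAsymptoticallyStableRel
        (SafeMonotoneFlow.safeMonotoneFlow α F g (SafeMonotoneFlow.affineMap H c))
        (SafeMonotoneFlow.constraintSet g (SafeMonotoneFlow.affineMap H c)) xs ∧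
      SafeMonotoneFlow.IsLyapunovFunctionOn
        (SafeMonotoneFlow.safeMonotoneFlow α F g (SafeMonotoneFlow.affineMap H c))
        (SafeMonotoneFlow.constraintSet g (SafeMonotoneFlow.affineMap H c)) xs
        (SafeMonotoneFlow.lyapunovCandidate α F g (SafeMonotoneFlow.affineMap H c) xs)
        (fun x => μ * ‖x - xs‖ ^ 2)) := by
  constructor
  · intro hmono
    have hFm : SafeMonotoneFlow.IsStronglyMonotoneMap 0 F := fun x y => by
      simpa using hmono x y
    refine ⟨SafeMonotoneFlow.globallyLyapunovStableRel_safeMonotoneFlow hα hF hFm hg hg_convex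
      hMFCQ hxs, ?_⟩
    simpa using SafeMonotoneFlow.isLyapunovFunctionOn_lyapunovCandidate hα le_rfl hF hFm hg
      hg_convex hMFCQ hxs
  · intro μ hμ hmono
    have hFm : SafeMonotoneFlow.IsStronglyMonotoneMap 0 F := fun x y => by
      refine le_trans ?_ (hmono x y)
      rw [zero_mul]
      positivity
    exact ⟨⟨SafeMonotoneFlow.globallyLyapunovStableRel_safeMonotoneFlow hα hF hFm hg hg_convex
        hMFCQ hxs,
      fun x hx h0 => SafeMonotoneFlow.tendsto_of_isSolutionOn_Ici hα hμ hF hmono hg hg_convex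
        hMFCQ hxs hx h0⟩,
      SafeMonotoneFlow.isLyapunovFunctionOn_lyapunovCandidate hα hμ.le hF hmono hg hg_convex
        hMFCQ hxs⟩
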